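/- **Setting.** Fix $p\ge 1$. For each $n$ (asymptotics as $n\to\infty$) let $Z_{ij}=Z_{ij}^{(n)}\in\mathbb R^p$, $1\le i\ne j\le n$, be deterministic covariates with $q=q_n:=\max_{i\neq j}\|Z_{ij}\|_\infty$ bounded in $n$. Let $\theta=(\alpha_1,\dots,\alpha_n,\beta_1,\dots,\beta_{n-1})$, with the convention $\beta_n=0$, $\gamma\in\mathbb R^p$, and put $$p_{ij}(\theta,\gamma)=\frac{e^{Z_{ij}^T\gamma+\alpha_i+\beta_j}}{1+e^{Z_{ij}^T\gamma+\alpha_i+\beta_j}} .$$ Let $\theta^*,\gamma^*$ be the true parameters (they may depend on $n$). The directed graph has adjacency matrix $(a_{ij})$ with $a_{ii}=0$ and independent edges $a_{ij}\in\{0,1\}$, $P(a_{ij}=1)=p_{ij}(\theta^*,\gamma^*)$ for $i\neq j$; $d_i=\sum_{j\ne i}a_{ij}$ and $b_j=\sum_{i\neq j}a_{ij}$ are the out- and in-degrees. Given privacy parameters $\epsilon_n>0$, let $\alpha_n=e^{-\epsilon_n/2}\in(0,1)$ and $\kappa_n=2(\log\frac1{\alpha_n})^{-1}=4/\epsilon_n$,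 and release $\tilde d_i=d_i+e_i^+$, $\tilde b_i=b_i+e_i^-$, where $e_i^{\pm}$, $1\le i\le n$, are i.i.d. discrete Laplace, $P(X=x)=\frac{1-\alpha_n}{1+\alpha_n}\alpha_n^{|x|}$ for $x\in\mathbb Z$, independent of the graph. Define $$F_i(\theta,\gamma)=\tilde d_i-\sum_{j\ne i}p_{ij}(\theta,\gamma)\ (1\le i\le n),\qquad F_{n+j}(\theta,\gamma)=\tilde b_j-\sum_{i\neq j}p_{ij}(\theta,\gamma)\ (1\le j\le n-1),$$ $$Q(\theta,\gamma)=\sum_{i\ne j}Z_{ij}\bigl(a_{ij}-p_{ij}(\theta,\gamma)\bigr).$$ A differentially private moment estimator $(\hat\theta,\hat\gamma)$ is a solution of $F(\hat\theta,\hat\gamma)=0$, $Q(\hat\theta,\hat\gamma)=0$. Let $$H(\theta,\gamma)=\frac{\partial Q}{\partial\gamma^T}-\frac{\partial Q}{\partial\theta^T}\Bigl[\frac{\partial F}{\partial\theta^T}\Bigr]^{-1}\frac{\partial F}{\partial\gamma^T},$$ which does not depend on the random data. Let $\epsilon_{n1},\epsilon_{n2}>0$ and $$\rho_n=\max_{i\ne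 j}|\alpha_i^*+\beta_j^*|+2\epsilon_{n1}+pq\|\gamma^*\|_\infty+pq\,\epsilon_{n2}.$$ **Theorem.** Suppose that the real numbers $\lambda_n$ are such that, for all large $n$ and every $\theta$ with $\|\theta-\theta^*\|_\infty\le\epsilon_{n1}$, the matrix $H(\theta,\gamma^*)$ is invertible and $\|H^{-1}(\theta,\gamma^*)\|_\infty\le\lambda_n/n^2$, where $\|\cdot\|_\infty$ of a matrix is the norm induced by the sup norm. Assume $$\lambda_n^2\,q\,e^{18\rho_n}(1+\kappa_n)^2=o(n/\log n).$$ Then, with probability tending to one, the estimator $(\hat\theta,\hat\gamma)$ exists, and $$\|\hat\theta-\theta^*\|_\infty=O_p\Bigl(\sqrt{\tfrac{\log n}{n}}\,(1+\kappa_n)e^{3\rho_n}\Bigr),\qquad \|\hat\gamma-\gamma^*\|_\infty=O_p\Bigl(\frac{\lambda_n\,q\,e^{9\rho_n}\log n}{n}(1+\kappa_n)^2\Bigr),$$ where each $O_p$ holds for every solution: for each $\delta>0$ there is $C>0$ such that, for all large $n$, the probability that some solution has error larger than $C$ times the rate is at most $\delta$. -/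

import Mathlib

open MeasureTheory ProbabilityTheory Filter Topology

noncomputable section

namespace PrivateBeta

/-- The logistic function `e^x / (1 + e^x)`. -/
def logistic (x : ℝ) : ℝ := Real.exp x / (1 + Real.exp x)

/-- Index set of `θ = (α_1, …, α_n, β_1, …, β_{n-1})`. The norm on `ThetaIdx n → ℝ` is the
sup norm. -/
abbrev ThetaIdx (n : ℕ) : Type := Fin n ⊕ Fin (n - 1)

/-- The out-parameter `α_i`. -/
def alpha {n : ℕ} (θ : ThetaIdx n → ℝ) (i : Fin n) : ℝ := θ (Sum.inl i)

/-- The in-parameter `β_j`, with the identifying convention that the last one is `0`. -/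
def beta {n : ℕ} (θ : ThetaIdx n → ℝ) (j : Fin n) : ℝ :=
  if h : (j : ℕ) < n - 1 then θ (Sum.inr ⟨j, h⟩) else 0

/-- The linear predictor `Z_ijᵀ γ + α_i + β_j`. -/
def linPred {n p : ℕ} (Z : Fin n → Fin n → Fin p → ℝ) (θ : ThetaIdx n → ℝ) (γ : Fin p → ℝ)
    (i j : Fin n) : ℝ :=
  ∑ k, Z i j k * γ k + alpha θ i + beta θ j

/-- The edge probability `e^{Z_ijᵀγ+α_i+β_j} / (1 + e^{Z_ijᵀγ+α_i+β_j})`. -/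
def edgeProb {n p : ℕ} (Z : Fin n → Fin n → Fin p → ℝ) (θ : ThetaIdx n → ℝ) (γ : Fin p → ℝ)
    (i j : Fin n) : ℝ :=
  logistic (linPred Z θ γ i j)

/-- Ordered pairs of distinct nodes. -/
abbrev OffDiag (n : ℕ) : Type := {e : Fin n × Fin n // e.1 ≠ e.2}

/-- Probability mass function of the discrete Laplace law with parameter `a ∈ (0,1)`. -/
def discreteLaplace (a : ℝ) (k : ℤ) : ℝ := (1 - a) / (1 + a) * a ^ k.natAbs

/-- The discrete Laplace parameter for privacy level `ε` and global sensitivity `2`,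
characterised by `2 (log (1 / a))⁻¹ = 4 / ε`. -/
def laplaceParam (ε : ℝ) : ℝ := Real.exp (-(ε / 2))

/-- The sub-exponential parameter `κ = 2 (log (1 / a))⁻¹ = 4 / ε` of the noise. -/
def kappa (ε : ℝ) : ℝ := 2 * (Real.log (1 / laplaceParam ε))⁻¹

/-- The out-degree of node `i`. -/
def outDegree {n : ℕ} (A : Fin n → Fin n → ℤ) (i : Fin n) : ℤ :=
  ∑ j ∈ Finset.univ.filter (fun j => j ≠ i), A i j

/-- The in-degree of node `j`. -/
def inDegree {n : ℕ} (A : Fin n → Fin n → ℤ) (j : Fin n) : ℤ :=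
  ∑ i ∈ Finset.univ.filter (fun i => i ≠ j), A i j

/-- The random adjacency matrix `A` follows the directed `β`-model with covariates `Z` and
parameters `(θ, γ)`; `eOut` and `eIn` are i.i.d. discrete Laplace noises for privacy level `ε`,
independent of the graph. -/
structure IsPrivateModel {n p : ℕ} {Ω : Type*} [MeasurableSpace Ω] (μ : Measure Ω)
    (Z : Fin n → Fin n → Fin p → ℝ) (θ : ThetaIdx n → ℝ) (γ : Fin p → ℝ) (ε : ℝ)
    (A : Ω → Fin n → Fin n → ℤ) (eOut eIn : Ω → Fin n → ℤ) : Prop where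
  measurable_edge : ∀ i j, Measurable fun ω => A ω i j
  measurable_out : ∀ i, Measurable fun ω => eOut ω i
  measurable_in : ∀ i, Measurable fun ω => eIn ω i
  no_loop : ∀ ω i, A ω i i = 0
  binary : ∀ ω i j, A ω i j = 0 ∨ A ω i j = 1
  edge_law : ∀ i j, i ≠ j → μ {ω | A ω i j = 1} = ENNReal.ofReal (edgeProb Z θ γ i j)
  out_law : ∀ i k, μ {ω | eOut ω i = k} = ENNReal.ofReal (discreteLaplace (laplaceParam ε) k)
  in_law : ∀ i k, μ {ω | eIn ω i = k} = ENNReal.ofReal (discreteLaplace (laplaceParam ε) k)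
  indep : iIndepFun (Sum.elim (fun (e : OffDiag n) (ω : Ω) => A ω e.1.1 e.1.2)
    (Sum.elim (fun (i : Fin n) (ω : Ω) => eOut ω i) (fun (i : Fin n) (ω : Ω) => eIn ω i))) μ

/-- The system `F(θ, γ)`: noisy degrees minus fitted degrees (out-degrees of all nodes, in-degrees
of all nodes but the last). -/
def F {n p : ℕ} (Z : Fin n → Fin n → Fin p → ℝ) (A : Fin n → Fin n → ℤ) (eOut eIn : Fin n → ℤ)
    (θ : ThetaIdx n → ℝ) (γ : Fin p → ℝ) : ThetaIdx n → ℝ :=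
  Sum.elim
    (fun i => ((outDegree A i + eOut i : ℤ) : ℝ) -
      ∑ j ∈ Finset.univ.filter (fun j => j ≠ i), edgeProb Z θ γ i j)
    (fun j' =>
      let j : Fin n := j'.castLE (Nat.sub_le n 1)
      ((inDegree A j + eIn j : ℤ) : ℝ) -
        ∑ i ∈ Finset.univ.filter (fun i => i ≠ j), edgeProb Z θ γ i j)

/-- The covariate equation `Q(θ, γ) = ∑_{i ≠ j} Z_ij (a_ij - p_ij(θ, γ))`. -/
def Q {n p : ℕ} (Z : Fin n → Fin n → Fin p → ℝ) (A : Fin n → Fin n → ℤ)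
    (θ : ThetaIdx n → ℝ) (γ : Fin p → ℝ) : Fin p → ℝ :=
  fun k => ∑ e : OffDiag n,
    Z e.1.1 e.1.2 k * ((A e.1.1 e.1.2 : ℝ) - edgeProb Z θ γ e.1.1 e.1.2)

/-- `(θ, γ)` is a differentially private moment estimate: it solves the moment equations with the
noisy bi-degree sequence. -/
def IsMomentEstimate {n p : ℕ} (Z : Fin n → Fin n → Fin p → ℝ) (A : Fin n → Fin n → ℤ)
    (eOut eIn : Fin n → ℤ) (θ : ThetaIdx n → ℝ) (γ : Fin p → ℝ) : Prop :=
  F Z A eOut eIn θ γ = 0 ∧ Q Z A θ γ = 0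

/-- The Jacobian matrix of `G` at `x`, made of partial derivatives. -/
def jac {ι κ : Type*} [DecidableEq κ] (G : (κ → ℝ) → ι → ℝ) (x : κ → ℝ) : Matrix ι κ ℝ :=
  Matrix.of fun i k => deriv (fun t => G (Function.update x k t) i) (x k)

/-- `H = ∂Q/∂γ - ∂Q/∂θ [∂F/∂θ]⁻¹ ∂F/∂γ`. The data `A, eOut, eIn` enter `F` and `Q` only through
additive constants, so `H` does not depend on them. -/
def H {n p : ℕ} (Z : Fin n → Fin n → Fin p → ℝ) (A : Fin n → Fin n → ℤ) (eOut eIn : Fin n → ℤ)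
    (θ : ThetaIdx n → ℝ) (γ : Fin p → ℝ) : Matrix (Fin p) (Fin p) ℝ :=
  jac (fun g => Q Z A θ g) γ -
    jac (fun t => Q Z A t γ) θ * (jac (fun t => F Z A eOut eIn t γ) θ)⁻¹ *
      jac (fun g => F Z A eOut eIn θ g) γ

/-- The matrix norm induced by the sup norm on vectors (maximal absolute row sum). -/
def linftyNorm {p : ℕ} (M : Matrix (Fin p) (Fin p) ℝ) : ℝ :=
  letI : NormedAddCommGroup (Matrix (Fin p) (Fin p) ℝ) := Matrix.linftyOpNormedAddCommGroup
  ‖M‖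

/-- `q = max_{i ≠ j} ‖Z_ij‖_∞`. -/
def covMax {n p : ℕ} (Z : Fin n → Fin n → Fin p → ℝ) : ℝ :=
  ⨆ e : OffDiag n, ‖Z e.1.1 e.1.2‖

/-- `ρ = max_{i ≠ j} |α_i + β_j| + 2 ε₁ + p q ‖γ‖_∞ + p q ε₂`. -/
def rho {n p : ℕ} (Z : Fin n → Fin n → Fin p → ℝ) (θ : ThetaIdx n → ℝ) (γ : Fin p → ℝ)
    (ε₁ ε₂ : ℝ) : ℝ :=
  (⨆ e : OffDiag n, |alpha θ e.1.1 + beta θ e.1.2|) + 2 * ε₁ + p * covMax Z * ‖γ‖ +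
    p * covMax Z * ε₂

end PrivateBeta

end

/-! The data enter the moment equations only through additive constants, so the moment map is a
deterministic smooth map shifted by the data. Its differential is minus a Gram form of the linear
predictors with weights `p_ij (1 - p_ij)`. Invertibility of `H` at the true parameters says that no
nonzero direction is invisible to all predictors, a property that does not depend on the weights.
Hence the differential is onto at every point and, the logistic function being increasing, the map
is injective (`surjective_momentDeriv`, `momentMap_injective`). There is at most one solution, and
it remains to find one near the truth.

Existence is by continuation: `exists_eq_of_a_priori` deforms the residual at the true parameters to
zero, and succeeds if the solutions met in a small box never touch its boundary. Two a priori bounds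
ensure this.

For `θ`, the mean value theorem turns `F` into a bipartite system in `α_i + β_j` with weights
between `m`, of order `e^{-ρ}`, and `1/4`. `abs_le_of_weighted_sums` inverts it in sup norm at a
cost of order `1 / (m² n)`.

For `γ`, one subtracts from `Q` the combination of `F` given by the weighted projection of the
covariates on the node effects. By orthogonality (`sum_weight_resid_lin`) the first-order effect of
`θ` disappears and that of `γ` is `H`; only a quadratic Taylor remainder is left. The error of `γ`
is thus of second order in that of `θ`, whence `log n / n` in place of its square root.

The residuals at the true parameters are controlled by Hoeffding's inequality for the degrees, an
exponential moment for single noises, and Chebyshev's inequality for the total noise and the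
projected covariate equation (`exists_event_residuals_le`). Finally, the entries of `H` are at most
`n² q² / 4`, so `λ p q² ≥ 4`; therefore the rate condition, although weighted by `λ² q`, makes
`e^{18ρ} (1 + κ)² log n / n` itself small. -/

namespace PrivateBeta

/-! ### Calculus of the logistic function. -/

/-- The derivative of the logistic function. -/
noncomputable def logisticDeriv (x : ℝ) : ℝ := logistic x * (1 - logistic x)

lemma logistic_pos (x : ℝ) : 0 < logistic x := by unfold logistic; positivity

lemma one_sub_logistic (x : ℝ) : 1 - logistic x = 1 / (1 + Real.exp x) := by
  unfold logistic
  field_simp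
  ring

lemma logistic_lt_one (x : ℝ) : logistic x < 1 := by
  have : 0 < 1 - logistic x := by rw [one_sub_logistic]; positivity
  linarith

lemma hasDerivAt_logistic (x : ℝ) : HasDerivAt logistic (logisticDeriv x) x := by
  have h1 : HasDerivAt (fun x => Real.exp x) (Real.exp x) x := Real.hasDerivAt_exp x
  have h2 := h1.div (h1.const_add 1) (by positivity)
  refine h2.congr_deriv ?_
  rw [logisticDeriv, one_sub_logistic, logistic]
  field_simp
  ring

lemma logisticDeriv_pos (x : ℝ) : 0 < logisticDeriv x :=
  mul_pos (logistic_pos x) (by linarith [logistic_lt_one x])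

lemma logisticDeriv_le (x : ℝ) : logisticDeriv x ≤ 1 / 4 := by
  unfold logisticDeriv; nlinarith [sq_nonneg (logistic x - 1 / 2)]

/-- The derivative equals `e^{-|x|} / (1 + e^{-|x|})²`, and the denominator is at most 4. -/
lemma exp_neg_abs_le_logisticDeriv (x : ℝ) : Real.exp (-|x|) / 4 ≤ logisticDeriv x := by
  rw [logisticDeriv, one_sub_logistic, logistic, div_mul_div_comm, mul_one,
    div_le_div_iff₀ (by norm_num) (by positivity)]
  rcases le_total 0 x with h | h
  · rw [abs_of_nonneg h, Real.exp_neg]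
    have h1 : 1 ≤ Real.exp x := Real.one_le_exp h
    rw [inv_mul_le_iff₀ (by positivity)]
    nlinarith
  · rw [abs_of_nonpos h, neg_neg]
    have h1 : Real.exp x ≤ 1 := Real.exp_le_one_iff.2 h
    have h2 := Real.exp_pos x
    refine mul_le_mul_of_nonneg_left ?_ h2.le
    nlinarith

lemma exists_logistic_sub_eq (x y : ℝ) :
    ∃ ξ, |ξ - x| ≤ |y - x| ∧ logistic y - logistic x = logisticDeriv ξ * (y - x) := by
  have hc : Continuous logistic :=
    continuous_iff_continuousAt.2 fun x => (hasDerivAt_logistic x).continuousAt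
  rcases lt_trichotomy x y with h | h | h
  · obtain ⟨ξ, hξ, h1⟩ := exists_hasDerivAt_eq_slope logistic logisticDeriv h hc.continuousOn
      fun z _ => hasDerivAt_logistic z
    refine ⟨ξ, ?_, ?_⟩
    · rw [abs_of_pos (by linarith [hξ.1]), abs_of_pos (by linarith)]; linarith [hξ.2]
    · rw [h1]; field_simp [sub_ne_zero.2 h.ne']
  · subst h; exact ⟨x, by simp⟩
  · obtain ⟨ξ, hξ, h1⟩ := exists_hasDerivAt_eq_slope logistic logisticDeriv h hc.continuousOn
      fun z _ => hasDerivAt_logistic z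
    refine ⟨ξ, ?_, ?_⟩
    · rw [abs_of_neg (by linarith [hξ.2]), abs_of_neg (by linarith)]; linarith [hξ.1]
    · have : x - y ≠ 0 := sub_ne_zero.2 h.ne'
      rw [h1]; field_simp; ring

lemma hasDerivAt_logisticDeriv (x : ℝ) :
    HasDerivAt logisticDeriv (logisticDeriv x * (1 - 2 * logistic x)) x := by
  have h := (hasDerivAt_logistic x).mul ((hasDerivAt_logistic x).const_sub 1)
  refine h.congr_deriv ?_
  ring

lemma abs_logisticDeriv_sub_le (x y : ℝ) : |logisticDeriv y - logisticDeriv x| ≤ |y - x| / 4 := by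
  have h := Convex.norm_image_sub_le_of_norm_hasDerivWithin_le (f := logisticDeriv)
    (f' := fun x => logisticDeriv x * (1 - 2 * logistic x)) (s := Set.univ) (C := 1 / 4)
    (x := x) (y := y) (fun z _ => (hasDerivAt_logisticDeriv z).hasDerivWithinAt)
    (fun z _ => by
      rw [Real.norm_eq_abs, abs_mul, abs_of_pos (logisticDeriv_pos z)]
      have h1 : |1 - 2 * logistic z| ≤ 1 :=
        abs_le.2 ⟨by linarith [logistic_lt_one z], by linarith [logistic_pos z]⟩
      nlinarith [logisticDeriv_pos z, logisticDeriv_le z]) convex_univ trivial trivial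
  rw [Real.norm_eq_abs, Real.norm_eq_abs] at h
  linarith

/-- Controls the remainder that survives in the covariate equation after its first-order part in the
node effects has cancelled. -/
lemma abs_logistic_taylor_le (x y : ℝ) :
    |logistic y - logistic x - logisticDeriv x * (y - x)| ≤ (y - x) ^ 2 / 4 := by
  obtain ⟨ξ, h1, h2⟩ := exists_logistic_sub_eq x y
  rw [h2, ← sub_mul, abs_mul, ← sq_abs]
  nlinarith [abs_logisticDeriv_sub_le x ξ, abs_nonneg (y - x)]

lemma logistic_strictMono : StrictMono logistic :=
  strictMono_of_hasDerivAt_pos hasDerivAt_logistic logisticDeriv_pos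

/-! ### Sup-norm stability of weighted bipartite systems without loops. -/

section SupNorm

variable {n : ℕ}

/-- One-sided version of `abs_le_of_weighted_sums`, for a maximum attained on the first side. -/
lemma sub_le_of_weighted_sums {m M δ R : ℝ} {v : Fin n → Fin n → ℝ} {a c : Fin n → ℝ}
    (hm : 0 < m) (hδ : 0 ≤ δ) (hn : 4 * M ≤ m * (n - 1))
    (hv : ∀ i j, i ≠ j → m ≤ v i j ∧ v i j ≤ M)
    (hrow : ∀ i, |∑ j ∈ Finset.univ.filter (· ≠ i), v i j * (a i - c j)| ≤ δ)
    (hcol : ∀ j, |∑ i ∈ Finset.univ.filter (· ≠ j), v i j * (a i - c j)| ≤ δ)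
    {i₀ : Fin n} (hmM : m ≤ M) (ha : ∀ i, a i ≤ a i₀) (hc : ∀ j, c j ≤ a i₀)
    (hRc : ∀ j, a i₀ - c j ≤ R) :
    (∀ i, a i₀ - a i ≤ 3 * (M * δ / (m ^ 2 * (n - 1))) + R / 4) ∧
      ∀ j, a i₀ - c j ≤ 3 * (M * δ / (m ^ 2 * (n - 1))) + R / 4 := by
  set U := a i₀
  have hM : 0 < M := hm.trans_le hmM
  have hN : (0 : ℝ) < n - 1 := by
    by_contra h
    have : m * ((n : ℝ) - 1) ≤ 0 := mul_nonpos_of_nonneg_of_nonpos hm.le (not_lt.1 h)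
    linarith
  have hcard : ∀ i : Fin n, (∑ j ∈ Finset.univ.filter (· ≠ i), (1 : ℝ)) = n - 1 := by
    intro i
    have : 1 ≤ n := i.pos
    simp [Finset.filter_ne', Finset.card_erase_of_mem, this]
  set X := M * δ / (m ^ 2 * (n - 1)) with hX
  have hXe : m * (n - 1) * X = M * δ / m := by rw [hX]; field_simp
  have hδX : δ ≤ M * δ / m := by
    rw [le_div_iff₀ hm]; nlinarith
  have hR : 0 ≤ R := (sub_nonneg.2 (hc i₀)).trans (hRc i₀)
  -- the in-values are close to the maximum on average
  have h1 : ∑ j ∈ Finset.univ.filter (· ≠ i₀), (U - c j) ≤ δ / m := by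
    rw [le_div_iff₀ hm, Finset.sum_mul]
    refine le_trans (Finset.sum_le_sum fun j hj => ?_) ((le_abs_self _).trans (hrow i₀))
    have := (hv i₀ j (Ne.symm (Finset.mem_filter.1 hj).2)).1
    rw [mul_comm]
    exact mul_le_mul_of_nonneg_right this (sub_nonneg.2 (hc j))
  -- Row `i` may contain the index `i₀`, which row `i₀` lacks; the spread `R` pays for this one
  -- term.
  have h2 : ∀ i, ∑ j ∈ Finset.univ.filter (· ≠ i), v i j * (U - c j) ≤ M * (δ / m + R) := by
    intro i
    have e1 : ∑ j ∈ Finset.univ.filter (· ≠ i), v i j * (U - c j) ≤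
        ∑ j ∈ Finset.univ.filter (· ≠ i), M * (U - c j) :=
      Finset.sum_le_sum fun j hj => mul_le_mul_of_nonneg_right
        (hv i j (Ne.symm (Finset.mem_filter.1 hj).2)).2 (sub_nonneg.2 (hc j))
    have e2 : ∑ j ∈ Finset.univ.filter (· ≠ i), M * (U - c j) ≤ ∑ j, M * (U - c j) :=
      Finset.sum_le_univ_sum_of_nonneg fun j => mul_nonneg hM.le (sub_nonneg.2 (hc j))
    have e3 : ∑ j, (U - c j) = (∑ j ∈ Finset.univ.filter (· ≠ i₀), (U - c j)) + (U - c i₀) := by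
      rw [Finset.filter_ne', Finset.sum_erase_add _ _ (Finset.mem_univ _)]
    refine e1.trans (e2.trans ?_)
    rw [← Finset.mul_sum, e3]
    have := hRc i₀
    gcongr
  have hrowa : ∀ i, U - a i ≤ 2 * X + R / 4 := by
    intro i
    have e1 := neg_le_of_abs_le (hrow i)
    have e2 : ∑ j ∈ Finset.univ.filter (· ≠ i), v i j * (a i - c j) =
        ∑ j ∈ Finset.univ.filter (· ≠ i), v i j * (U - c j) -
          ∑ j ∈ Finset.univ.filter (· ≠ i), v i j * (U - a i) := by
      rw [← Finset.sum_sub_distrib]; exact Finset.sum_congr rfl fun j _ => by ring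
    have e3 : m * (n - 1) * (U - a i) ≤
        ∑ j ∈ Finset.univ.filter (· ≠ i), v i j * (U - a i) := by
      rw [← hcard i, Finset.mul_sum, Finset.sum_mul]
      refine Finset.sum_le_sum fun j hj => ?_
      rw [mul_one]
      exact mul_le_mul_of_nonneg_right (hv i j (Ne.symm (Finset.mem_filter.1 hj).2)).1
        (sub_nonneg.2 (ha i))
    have e4 := h2 i
    -- Both `δ` and `M * δ / m` are at most `m * (n - 1) * X`, and `hn` makes the single extra term
    -- `M * R` a quarter of `m * (n - 1) * R`.
    have e5 : m * (n - 1) * (U - a i) ≤ m * (n - 1) * (2 * X + R / 4) := by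
      have : M * (δ / m + R) = M * δ / m + M * R := by ring
      nlinarith
    exact le_of_mul_le_mul_left e5 (by positivity)
  have hX0 : 0 ≤ X := by positivity
  refine ⟨fun i => by linarith [hrowa i], fun j => ?_⟩
  have e1 := le_of_abs_le (hcol j)
  have e2 : ∑ i ∈ Finset.univ.filter (· ≠ j), v i j * (a i - c j) =
      ∑ i ∈ Finset.univ.filter (· ≠ j), v i j * ((U - c j - (2 * X + R / 4)) +
        ((2 * X + R / 4) - (U - a i))) :=
    Finset.sum_congr rfl fun j _ => by ring
  -- Otherwise every term of column `j` exceeds `m * X`, and the column sum exceeds `M * δ / m ≥ δ`.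
  by_contra hlt
  push Not at hlt
  have e3 : m * (n - 1) * (U - c j - (2 * X + R / 4)) ≤
      ∑ i ∈ Finset.univ.filter (· ≠ j), v i j * (a i - c j) := by
    rw [e2, ← hcard j, Finset.mul_sum, Finset.sum_mul]
    refine Finset.sum_le_sum fun i hi => ?_
    rw [mul_one]
    have hvi := (hv i j (Finset.mem_filter.1 hi).2).1
    have := hrowa i
    exact mul_le_mul hvi (by linarith) (by linarith) (hm.le.trans hvi)
  have e4 : m * (n - 1) * X < m * (n - 1) * (U - c j - (2 * X + R / 4)) :=
    mul_lt_mul_of_pos_left (by linarith) (by positivity)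
  linarith

/-- Sup-norm stability of the weighted bipartite system `v i j * (a i + b j)`. -/
lemma abs_le_of_weighted_sums {m M δ : ℝ} {v : Fin n → Fin n → ℝ} {a b : Fin n → ℝ}
    (hm : 0 < m) (hδ : 0 ≤ δ) (hmM : m ≤ M) (hn : 4 * M ≤ m * (n - 1))
    (hv : ∀ i j, i ≠ j → m ≤ v i j ∧ v i j ≤ M)
    (hrow : ∀ i, |∑ j ∈ Finset.univ.filter (· ≠ i), v i j * (a i + b j)| ≤ δ)
    (hcol : ∀ j, |∑ i ∈ Finset.univ.filter (· ≠ j), v i j * (a i + b j)| ≤ δ)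
    {j₀ : Fin n} (hj₀ : b j₀ = 0) :
    (∀ i, |a i| ≤ 4 * (M * δ / (m ^ 2 * (n - 1)))) ∧
      ∀ j, |b j| ≤ 4 * (M * δ / (m ^ 2 * (n - 1))) := by
  set X := M * δ / (m ^ 2 * (n - 1)) with hX
  -- the spread of all the values `a i`, `-b j`
  suffices h : ∃ U, (∀ i, a i ≤ U ∧ U - a i ≤ 4 * X) ∧ ∀ j, -b j ≤ U ∧ U + b j ≤ 4 * X by
    obtain ⟨U, h1, h2⟩ := h
    have h3 := h2 j₀
    rw [hj₀] at h3
    constructor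
    · intro i; have := h1 i; rw [abs_le]; constructor <;> linarith
    · intro i; have := h2 i; rw [abs_le]; constructor <;> linarith
  have : Nonempty (Fin n) := ⟨j₀⟩
  obtain ⟨i₁, hi₁⟩ := Finite.exists_max a
  obtain ⟨j₁, hj₁⟩ := Finite.exists_min b
  obtain ⟨i₂, hi₂⟩ := Finite.exists_min a
  obtain ⟨j₂, hj₂⟩ := Finite.exists_max b
  rcases le_total (-b j₁) (a i₁) with hU | hU
  · set R := max (a i₁ - a i₂) (a i₁ + b j₂)
    have key := sub_le_of_weighted_sums (c := fun j => -b j) (R := R) hm hδ hn hv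
      (by simpa using hrow) (by simpa using hcol) hmM hi₁
      (fun j => (neg_le_neg (hj₁ j)).trans hU)
      (fun j => le_max_of_le_right (by linarith [hj₂ j]))
    -- `R` is the actual spread below the maximum, so the one-sided bound applies to `R` itself and
    -- improves to `R ≤ 4 * X`.
    have hR : R ≤ 3 * X + R / 4 := max_le (key.1 i₂) (by simpa using key.2 j₂)
    refine ⟨a i₁, fun i => ⟨hi₁ i, by linarith [key.1 i]⟩,
      fun j => ⟨(neg_le_neg (hj₁ j)).trans hU, ?_⟩⟩
    have := key.2 j
    simp only [sub_neg_eq_add] at this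
    linarith
  · set R := max (-b j₁ - a i₂) (-b j₁ + b j₂)
    have e' : ∀ i j : Fin n, v i j * (-b j - a i) = -(v i j * (a i + b j)) := fun i j => by ring
    -- The maximum lies on the in-side: the system is transposed.
    have key := sub_le_of_weighted_sums (v := fun j i => v i j) (a := fun j => -b j) (c := a)
      (i₀ := j₁) (R := R) hm hδ hn (fun i j h => hv j i h.symm)
      (by simp only [e', Finset.sum_neg_distrib, abs_neg]; exact hcol)
      (by simp only [e', Finset.sum_neg_distrib, abs_neg]; exact hrow) hmM
      (fun j => neg_le_neg (hj₁ j)) (fun i => (hi₁ i).trans hU)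
      (fun i => le_max_of_le_left (by linarith [hi₂ i]))
    have hR : R ≤ 3 * X + R / 4 := max_le (key.2 i₂) (by simpa using key.1 j₂)
    refine ⟨-b j₁, fun i => ⟨(hi₁ i).trans hU, by linarith [key.2 i]⟩,
      fun j => ⟨neg_le_neg (hj₁ j), ?_⟩⟩
    have := key.1 j
    simp only [sub_neg_eq_add] at this
    linarith

end SupNorm

end PrivateBeta

/-! ### Node effects as linear forms, and the moment equations tested against them. -/

namespace PrivateBeta

variable {n p : ℕ}

/-- The linear form `θ ↦ α_i + β_j` attached to the ordered pair `(i, j)`. -/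
noncomputable def lin (w : ThetaIdx n → ℝ) (e : OffDiag n) : ℝ := alpha w e.1.1 + beta w e.1.2

lemma alpha_add (w x : ThetaIdx n → ℝ) (i : Fin n) : alpha (w + x) i = alpha w i + alpha x i := rfl

lemma beta_add (w x : ThetaIdx n → ℝ) (j : Fin n) : beta (w + x) j = beta w j + beta x j := by
  unfold beta; split_ifs <;> simp

lemma alpha_smul (c : ℝ) (w : ThetaIdx n → ℝ) (i : Fin n) : alpha (c • w) i = c * alpha w i := rfl

lemma beta_smul (c : ℝ) (w : ThetaIdx n → ℝ) (j : Fin n) : beta (c • w) j = c * beta w j := by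
  unfold beta; split_ifs <;> simp

/-- `lin` as a linear functional in the parameter. -/
noncomputable def linMap (e : OffDiag n) : (ThetaIdx n → ℝ) →ₗ[ℝ] ℝ where
  toFun w := lin w e
  map_add' w x := by simp only [lin, alpha_add, beta_add]; ring
  map_smul' c w := by simp only [lin, alpha_smul, beta_smul, smul_eq_mul, RingHom.id_apply]; ring

lemma lin_add (w x : ThetaIdx n → ℝ) (e : OffDiag n) : lin (w + x) e = lin w e + lin x e :=
  (linMap e).map_add w x

lemma lin_sub (w x : ThetaIdx n → ℝ) (e : OffDiag n) : lin (w - x) e = lin w e - lin x e :=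
  (linMap e).map_sub w x

lemma lin_smul (c : ℝ) (w : ThetaIdx n → ℝ) (e : OffDiag n) : lin (c • w) e = c * lin w e :=
  (linMap e).map_smul c w

lemma lin_eq_sum (w : ThetaIdx n → ℝ) (e : OffDiag n) :
    lin w e = ∑ s, w s * lin (Pi.single s 1) e := by
  have h := (linMap e).pi_apply_eq_sum_univ w
  simp only [smul_eq_mul] at h
  refine h.trans (Finset.sum_congr rfl fun s _ => ?_)
  congr 1
  change lin _ e = lin _ e
  congr 1
  funext t
  simp [Pi.single_apply, eq_comm]

lemma abs_alpha_le (w : ThetaIdx n → ℝ) (i : Fin n) : |alpha w i| ≤ ‖w‖ := norm_le_pi_norm w _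

lemma abs_beta_le (w : ThetaIdx n → ℝ) (j : Fin n) : |beta w j| ≤ ‖w‖ := by
  unfold beta
  split_ifs
  · exact norm_le_pi_norm w _
  · simp

lemma abs_lin_le (w : ThetaIdx n → ℝ) (e : OffDiag n) : |lin w e| ≤ 2 * ‖w‖ := by
  have := abs_add_le (alpha w e.1.1) (beta w e.1.2)
  have := abs_alpha_le w e.1.1
  have := abs_beta_le w e.1.2
  unfold lin
  linarith

lemma norm_le_of_alpha_beta {w : ThetaIdx n → ℝ} {r : ℝ} (hr : 0 ≤ r)
    (ha : ∀ i, |alpha w i| ≤ r) (hb : ∀ j, |beta w j| ≤ r) : ‖w‖ ≤ r := by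
  refine (pi_norm_le_iff_of_nonneg hr).2 ?_
  rintro (i | ⟨j, hj⟩)
  · exact ha i
  · have h := hb ⟨j, by omega⟩
    simpa only [beta, hj, dif_pos, Real.norm_eq_abs] using h

lemma exists_beta_eq_zero (hn : 0 < n) : ∃ j : Fin n, ∀ w : ThetaIdx n → ℝ, beta w j = 0 :=
  ⟨⟨n - 1, by omega⟩, fun w => by simp [beta]⟩

lemma sum_offDiag_row (f : Fin n → Fin n → ℝ) :
    ∑ e : OffDiag n, f e.1.1 e.1.2 = ∑ i, ∑ j ∈ Finset.univ.filter (fun j => j ≠ i), f i j := by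
  rw [← Finset.sum_subtype (Finset.univ.filter fun e : Fin n × Fin n => e.1 ≠ e.2) (by simp)
    (fun e : Fin n × Fin n => f e.1 e.2), Finset.sum_filter, Fintype.sum_prod_type]
  refine Finset.sum_congr rfl fun i _ => ?_
  rw [Finset.sum_filter]
  exact Finset.sum_congr rfl fun j _ => by simp only [ne_comm]

lemma sum_offDiag_col (f : Fin n → Fin n → ℝ) :
    ∑ e : OffDiag n, f e.1.1 e.1.2 = ∑ j, ∑ i ∈ Finset.univ.filter (fun i => i ≠ j), f i j := by
  rw [← Finset.sum_subtype (Finset.univ.filter fun e : Fin n × Fin n => e.1 ≠ e.2) (by simp)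
    (fun e : Fin n × Fin n => f e.1 e.2), Finset.sum_filter, Fintype.sum_prod_type_right]
  refine Finset.sum_congr rfl fun i _ => ?_
  rw [Finset.sum_filter]

lemma sum_inr_eq_sum_beta (w : ThetaIdx n → ℝ) (g : Fin n → ℝ) :
    ∑ j : Fin (n - 1), w (Sum.inr j) * g (j.castLE (Nat.sub_le n 1)) = ∑ j, beta w j * g j := by
  cases n with
  | zero => simp
  | succ k =>
    rw [Fin.sum_univ_castSucc]
    have : beta w (Fin.last k) = 0 := by simp [beta]
    rw [this, zero_mul, add_zero]
    refine Finset.sum_congr rfl fun j _ => ?_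
    have : beta w j.castSucc = w (Sum.inr j) := by
      have h : (j.castSucc : ℕ) < k + 1 - 1 := by simp
      unfold beta
      rw [dif_pos h]; rfl
    rw [this]; rfl

lemma sum_lin_mul (w : ThetaIdx n → ℝ) (y : Fin n → Fin n → ℝ) :
    ∑ e : OffDiag n, lin w e * y e.1.1 e.1.2 =
      ∑ i, alpha w i * ∑ j ∈ Finset.univ.filter (fun j => j ≠ i), y i j +
        ∑ j, beta w j * ∑ i ∈ Finset.univ.filter (fun i => i ≠ j), y i j := by
  simp only [lin, add_mul, Finset.sum_add_distrib, Finset.mul_sum]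
  rw [sum_offDiag_row fun i j => alpha w i * y i j, sum_offDiag_col fun i j => beta w j * y i j]

/-- The moment equations tested against a parameter vector `w`. -/
lemma sum_mul_F (Z : Fin n → Fin n → Fin p → ℝ) (A : Fin n → Fin n → ℤ) (eOut eIn : Fin n → ℤ)
    (θ : ThetaIdx n → ℝ) (γ : Fin p → ℝ) (w : ThetaIdx n → ℝ) :
    ∑ s, w s * F Z A eOut eIn θ γ s =
      ∑ e : OffDiag n, lin w e * ((A e.1.1 e.1.2 : ℝ) - edgeProb Z θ γ e.1.1 e.1.2) +
        (∑ i, alpha w i * eOut i + ∑ j, beta w j * eIn j) := by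
  rw [sum_lin_mul w fun i j => (A i j : ℝ) - edgeProb Z θ γ i j, Fintype.sum_sum_type]
  simp only [F, Sum.elim_inl, Sum.elim_inr]
  rw [sum_inr_eq_sum_beta w fun j => ((inDegree A j + eIn j : ℤ) : ℝ) -
        ∑ i ∈ Finset.univ.filter (fun i => i ≠ j), edgeProb Z θ γ i j]
  rw [add_add_add_comm]
  refine congrArg₂ (fun a b : ℝ => a + b) (Eq.trans ?_ Finset.sum_add_distrib)
    (Eq.trans ?_ Finset.sum_add_distrib)
  · refine Finset.sum_congr rfl fun i _ => ?_
    rw [Finset.sum_sub_distrib, outDegree, alpha]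
    push_cast
    ring
  · refine Finset.sum_congr rfl fun i _ => ?_
    rw [Finset.sum_sub_distrib, inDegree]
    push_cast
    ring

lemma F_apply (Z : Fin n → Fin n → Fin p → ℝ) (A : Fin n → Fin n → ℤ) (eOut eIn : Fin n → ℤ)
    (θ : ThetaIdx n → ℝ) (γ : Fin p → ℝ) (s : ThetaIdx n) :
    F Z A eOut eIn θ γ s =
      ∑ e : OffDiag n, lin (Pi.single s 1) e *
          ((A e.1.1 e.1.2 : ℝ) - edgeProb Z θ γ e.1.1 e.1.2) +
        (∑ i, alpha (Pi.single s 1) i * eOut i + ∑ j, beta (Pi.single s 1) j * eIn j) := by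
  rw [← sum_mul_F Z A eOut eIn θ γ (Pi.single s 1)]
  simp [Pi.single_apply]

/-- Row and column sums of an array are determined by its pairings with all the `lin w`. -/
lemma row_col_sum_of_lin_pairing {y : Fin n → Fin n → ℝ} {f h : Fin n → ℝ}
    (hy : ∀ w : ThetaIdx n → ℝ, ∑ e : OffDiag n, lin w e * y e.1.1 e.1.2 =
      ∑ i, alpha w i * f i + ∑ j, beta w j * h j) :
    (∀ i, ∑ j ∈ Finset.univ.filter (fun j => j ≠ i), y i j = f i) ∧
      ∀ j : Fin n, ∑ i ∈ Finset.univ.filter (fun i => i ≠ j), y i j =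
        if (j : ℕ) < n - 1 then h j else
          ∑ i, f i - ∑ j' : Fin n, if (j' : ℕ) < n - 1 then h j' else 0 := by
  have hrow : ∀ i, ∑ j ∈ Finset.univ.filter (fun j => j ≠ i), y i j = f i := by
    intro i
    have h1 := hy (Pi.single (Sum.inl i) 1)
    rw [sum_lin_mul] at h1
    have hb : ∀ j, beta (Pi.single (Sum.inl i) 1 : ThetaIdx n → ℝ) j = 0 := by
      intro j; simp [beta]
    have ha : ∀ j, alpha (Pi.single (Sum.inl i) 1 : ThetaIdx n → ℝ) j = if j = i then 1 else 0 := by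
      intro j; simp [alpha, Pi.single_apply]
    simpa [hb, ha] using h1
  refine ⟨hrow, fun j => ?_⟩
  split_ifs with hj
  · have h1 := hy (Pi.single (Sum.inr ⟨j, hj⟩) 1)
    rw [sum_lin_mul] at h1
    have ha : ∀ i, alpha (Pi.single (Sum.inr ⟨j, hj⟩) 1 : ThetaIdx n → ℝ) i = 0 := by
      intro i; simp [alpha]
    have hb : ∀ i, beta (Pi.single (Sum.inr ⟨j, hj⟩) 1 : ThetaIdx n → ℝ) i =
        if i = j then 1 else 0 := by
      intro i
      by_cases hij : i = j
      · subst hij; simp [beta, hj]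
      · have : (i : ℕ) ≠ j := fun h => hij (Fin.ext h)
        simp [beta, hij, this]
    simpa [hb, ha] using h1
  · have h1 := hy fun _ => 1
    have hrowcol : ∑ i, ∑ j ∈ Finset.univ.filter (fun j => j ≠ i), y i j =
        ∑ j, ∑ i ∈ Finset.univ.filter (fun i => i ≠ j), y i j := by
      rw [← sum_offDiag_row, ← sum_offDiag_col]
    -- Here `j` is the last node, which has no coordinate of its own. Since its `β` is 0, this
    -- vector pairs to 1 with the edges into `j` and to 0 with all others.
    have h2 := hy (Sum.elim (fun _ => 1) fun _ => -1)
    rw [sum_lin_mul] at h2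
    have hb : ∀ i, beta (Sum.elim (fun _ => 1) fun _ => -1 : ThetaIdx n → ℝ) i =
        (if i = j then 1 else 0) - 1 := by
      intro i
      have hiff : (i : ℕ) < n - 1 ↔ i ≠ j := by
        rw [Ne, Fin.ext_iff]; have := i.2; have := j.2; omega
      by_cases hij : i = j
      · subst hij; simp [beta, hj]
      · simp [beta, hiff, hij]
    have ha : ∀ i, alpha (Sum.elim (fun _ => 1) fun _ => -1 : ThetaIdx n → ℝ) i = 1 := by
      intro i; simp [alpha]
    simp only [ha, hb, one_mul, sub_mul, Finset.sum_sub_distrib, ite_mul, zero_mul,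
      Finset.sum_ite_eq', Finset.mem_univ, if_true] at h2
    have h3 : ∑ j' : Fin n, (if (j' : ℕ) < n - 1 then h j' else 0) = ∑ j', h j' - h j := by
      rw [eq_sub_iff_add_eq, ← Finset.sum_erase_add Finset.univ h (Finset.mem_univ j),
        ← Finset.filter_ne', Finset.sum_filter]
      congr 1
      refine Finset.sum_congr rfl fun i _ => ?_
      have hiff : (i : ℕ) < n - 1 ↔ i ≠ j := by
        rw [Ne, Fin.ext_iff]; have := i.2; have := j.2; omega
      simp [hiff]
    linarith

/-- Identifiability of the node effects: pairs into the last node give `α_i`, and a third node links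
the rest. With two nodes the direction `α_2 = -β_1` would be invisible. -/
lemma eq_zero_of_lin_eq_zero (hn : 3 ≤ n) {x : ThetaIdx n → ℝ} (hx : ∀ e, lin x e = 0) :
    x = 0 := by
  obtain ⟨l, hl⟩ := exists_beta_eq_zero (n := n) (by omega)
  have h : ∀ i j, i ≠ j → alpha x i + beta x j = 0 := fun i j hij => hx ⟨(i, j), hij⟩
  have ha : ∀ i, i ≠ l → alpha x i = 0 := fun i hi => by have := h i l hi; rw [hl] at this; linarith
  have hex : ∀ j : Fin n, ∃ i, i ≠ j ∧ i ≠ l := by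
    intro j
    have : ({j, l} : Finset (Fin n)).card < (Finset.univ : Finset (Fin n)).card :=
      (Finset.card_le_two).trans_lt (by simp; omega)
    obtain ⟨i, _, hi⟩ := Finset.exists_mem_notMem_of_card_lt_card this
    exact ⟨i, by simpa using hi⟩
  have hb : ∀ j, beta x j = 0 := fun j => by
    obtain ⟨i, h1, h2⟩ := hex j
    have := h i j h1
    rw [ha i h2] at this; linarith
  have ha' : ∀ i, alpha x i = 0 := fun i => by
    obtain ⟨j, h1, _⟩ := hex i
    have := h i j h1.symm
    rw [hb j] at this; linarith
  exact norm_le_zero_iff.1 (norm_le_of_alpha_beta le_rfl (fun i => by simp [ha'])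
    (fun i => by simp [hb]))

lemma linPred_eq (Z : Fin n → Fin n → Fin p → ℝ) (θ : ThetaIdx n → ℝ) (γ : Fin p → ℝ)
    (e : OffDiag n) :
    linPred Z θ γ e.1.1 e.1.2 = lin θ e + ∑ k, Z e.1.1 e.1.2 k * γ k := by
  unfold linPred lin; ring

lemma linPred_update_theta (Z : Fin n → Fin n → Fin p → ℝ) (θ : ThetaIdx n → ℝ) (γ : Fin p → ℝ)
    (s : ThetaIdx n) (t : ℝ) (e : OffDiag n) :
    linPred Z (Function.update θ s t) γ e.1.1 e.1.2 =
      linPred Z θ γ e.1.1 e.1.2 + (t - θ s) * lin (Pi.single s 1) e := by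
  have h : Function.update θ s t = θ + (t - θ s) • Pi.single s 1 := by
    ext s'
    by_cases hs : s' = s
    · subst hs; simp
    · simp [hs]
  rw [linPred_eq, linPred_eq, h, lin_add, lin_smul]
  ring

lemma linPred_update_gamma (Z : Fin n → Fin n → Fin p → ℝ) (θ : ThetaIdx n → ℝ) (γ : Fin p → ℝ)
    (k : Fin p) (t : ℝ) (e : OffDiag n) :
    linPred Z θ (Function.update γ k t) e.1.1 e.1.2 =
      linPred Z θ γ e.1.1 e.1.2 + (t - γ k) * Z e.1.1 e.1.2 k := by
  have h : ∀ k', Function.update γ k t k' = γ k' + if k' = k then t - γ k else 0 := by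
    intro k'
    by_cases hs : k' = k
    · subst hs; simp
    · simp [hs]
  rw [linPred_eq, linPred_eq]
  simp only [h, mul_add, Finset.sum_add_distrib, mul_ite, mul_zero, Finset.sum_ite_eq',
    Finset.mem_univ, if_true]
  ring

lemma deriv_sum_logistic (c a L l : OffDiag n → ℝ) (k t₀ : ℝ) :
    deriv (fun t => ∑ e, c e * (a e - logistic (L e + (t - t₀) * l e)) + k) t₀ =
      -∑ e, c e * (logisticDeriv (L e) * l e) := by
  refine HasDerivAt.deriv ?_
  rw [← Finset.sum_neg_distrib]
  refine HasDerivAt.add_const _ (HasDerivAt.fun_sum fun e _ => ?_)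
  have h1 : HasDerivAt (fun t => L e + (t - t₀) * l e) (l e) t₀ := by
    simpa using (((hasDerivAt_id t₀).sub_const t₀).mul_const (l e)).const_add (L e)
  have h2 : HasDerivAt logistic (logisticDeriv (L e)) (L e + (t₀ - t₀) * l e) := by
    simpa using hasDerivAt_logistic (L e)
  have h3 := ((h2.comp t₀ h1).const_sub (a e)).const_mul (c e)
  refine h3.congr_deriv (by ring)

/-! ### Jacobians, the weighted projection on node effects, and the form of `H`. -/

section Jacobians

variable (Z : Fin n → Fin n → Fin p → ℝ) (A : Fin n → Fin n → ℤ) (eOut eIn : Fin n → ℤ)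
  (θ : ThetaIdx n → ℝ) (γ : Fin p → ℝ)

/-- The logistic weight `p_ij (1 - p_ij)`. -/
noncomputable def weight (e : OffDiag n) : ℝ := logisticDeriv (linPred Z θ γ e.1.1 e.1.2)

lemma weight_pos (e : OffDiag n) : 0 < weight Z θ γ e := logisticDeriv_pos _

lemma weight_le (e : OffDiag n) : weight Z θ γ e ≤ 1 / 4 := logisticDeriv_le _

lemma jac_F_theta (s s' : ThetaIdx n) :
    jac (fun t => F Z A eOut eIn t γ) θ s s' =
      -∑ e, lin (Pi.single s 1) e * (weight Z θ γ e * lin (Pi.single s' 1) e) := by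
  simp only [jac, Matrix.of_apply, F_apply, edgeProb, linPred_update_theta]
  exact deriv_sum_logistic _ _ _ _ _ _

lemma jac_F_gamma (s : ThetaIdx n) (l : Fin p) :
    jac (fun g => F Z A eOut eIn θ g) γ s l =
      -∑ e, lin (Pi.single s 1) e * (weight Z θ γ e * Z e.1.1 e.1.2 l) := by
  simp only [jac, Matrix.of_apply, F_apply, edgeProb, linPred_update_gamma]
  exact deriv_sum_logistic _ _ _ _ _ _

lemma jac_Q_theta (k : Fin p) (s : ThetaIdx n) :
    jac (fun t => Q Z A t γ) θ k s =
      -∑ e, Z e.1.1 e.1.2 k * (weight Z θ γ e * lin (Pi.single s 1) e) := by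
  simp only [jac, Matrix.of_apply, Q, edgeProb, linPred_update_theta]
  have := deriv_sum_logistic (fun e : OffDiag n => Z e.1.1 e.1.2 k) (fun e => A e.1.1 e.1.2)
    (fun e => linPred Z θ γ e.1.1 e.1.2) (fun e => lin (Pi.single s 1) e) 0 (θ s)
  simpa only [add_zero, weight] using this

lemma jac_Q_gamma (k l : Fin p) :
    jac (fun g => Q Z A θ g) γ k l =
      -∑ e : OffDiag n, Z e.1.1 e.1.2 k * (weight Z θ γ e * Z e.1.1 e.1.2 l) := by
  simp only [jac, Matrix.of_apply, Q, edgeProb, linPred_update_gamma]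
  have := deriv_sum_logistic (fun e : OffDiag n => Z e.1.1 e.1.2 k) (fun e => A e.1.1 e.1.2)
    (fun e => linPred Z θ γ e.1.1 e.1.2) (fun e => Z e.1.1 e.1.2 l) 0 (γ l)
  simpa only [add_zero, weight] using this

/-- The quadratic form of the Jacobian is `-∑ weight * lin²`; it is definite because the weights are
positive and the node effects identifiable. -/
lemma isUnit_jac_F_theta (hn : 3 ≤ n) :
    IsUnit (jac (fun t => F Z A eOut eIn t γ) θ).det := by
  rw [isUnit_iff_ne_zero]
  intro h0
  obtain ⟨x, hx0, hx⟩ := Matrix.exists_mulVec_eq_zero_iff.2 h0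
  apply hx0
  have h1 : ∑ s, x s * (Matrix.mulVec (jac (fun t => F Z A eOut eIn t γ) θ) x) s =
      -∑ e, weight Z θ γ e * lin x e ^ 2 := by
    have h2 : ∀ s, (Matrix.mulVec (jac (fun t => F Z A eOut eIn t γ) θ) x) s =
        -∑ e, lin (Pi.single s 1) e * (weight Z θ γ e * lin x e) := by
      intro s
      simp only [Matrix.mulVec, dotProduct, jac_F_theta]
      simp only [lin_eq_sum x, Finset.mul_sum, neg_mul, Finset.sum_neg_distrib, Finset.sum_mul]
      rw [Finset.sum_comm]
      congr 1
      refine Finset.sum_congr rfl fun e _ => Finset.sum_congr rfl fun s _ => by ring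
    simp only [h2, mul_neg, Finset.sum_neg_distrib, Finset.mul_sum]
    rw [Finset.sum_comm]
    congr 1
    refine Finset.sum_congr rfl fun e _ => ?_
    rw [sq, ← mul_assoc]
    conv_rhs => rw [mul_comm]; arg 1; rw [lin_eq_sum]
    rw [Finset.sum_mul]
    refine Finset.sum_congr rfl fun s _ => by ring
  rw [hx] at h1
  simp only [Pi.zero_apply, mul_zero, Finset.sum_const_zero] at h1
  have h3 := (Finset.sum_eq_zero_iff_of_nonneg fun e _ =>
    mul_nonneg (weight_pos Z θ γ e).le (sq_nonneg (lin x e))).1 (neg_eq_zero.1 h1.symm)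
  refine eq_zero_of_lin_eq_zero hn fun e => ?_
  simpa [(weight_pos Z θ γ e).ne'] using h3 e (Finset.mem_univ e)

/-- The rows of `∂Q/∂θ (∂F/∂θ)⁻¹`, the coefficients of the weighted projection of the
covariates on the span of the node effects. -/
noncomputable def projCoeff (k : Fin p) (s : ThetaIdx n) : ℝ :=
  (jac (fun t => Q Z A t γ) θ * (jac (fun t => F Z A eOut eIn t γ) θ)⁻¹) k s

/-- The projection is not random. This allows fixed coefficients in Chebyshev's inequality. -/
lemma projCoeff_data (A' : Fin n → Fin n → ℤ) (eOut' eIn' : Fin n → ℤ) :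
    projCoeff Z A eOut eIn θ γ = projCoeff Z A' eOut' eIn' θ γ := by
  have h1 : jac (fun t => Q Z A t γ) θ = jac (fun t => Q Z A' t γ) θ := by
    ext k s; simp only [jac_Q_theta]
  have h2 : jac (fun t => F Z A eOut eIn t γ) θ = jac (fun t => F Z A' eOut' eIn' t γ) θ := by
    ext k s; simp only [jac_F_theta]
  ext k s
  rw [projCoeff, projCoeff, h1, h2]

/-- The covariates with the node effects projected out. -/
noncomputable def resid (k : Fin p) (e : OffDiag n) : ℝ :=
  Z e.1.1 e.1.2 k - lin (projCoeff Z A eOut eIn θ γ k) e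

/-- The normal equations of weighted least squares: multiplying `projCoeff` by `∂F/∂θ` returns
`∂Q/∂θ`. -/
lemma sum_weight_resid_lin (hn : 3 ≤ n) (k : Fin p) (x : ThetaIdx n → ℝ) :
    ∑ e, weight Z θ γ e * resid Z A eOut eIn θ γ k e * lin x e = 0 := by
  have hsingle : ∀ s, ∑ e, weight Z θ γ e * resid Z A eOut eIn θ γ k e *
      lin (Pi.single s 1) e = 0 := by
    intro s
    have h1 := Matrix.nonsing_inv_mul_cancel_right (jac (fun t => F Z A eOut eIn t γ) θ)
      (jac (fun t => Q Z A t γ) θ) (isUnit_jac_F_theta Z A eOut eIn θ γ hn)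
    have h2 := congrFun (congrFun h1 k) s
    rw [Matrix.mul_apply, jac_Q_theta] at h2
    simp only [jac_F_theta] at h2
    have h3 : ∑ s', projCoeff Z A eOut eIn θ γ k s' *
        -∑ e, lin (Pi.single s' 1) e * (weight Z θ γ e * lin (Pi.single s 1) e) =
        -∑ e, lin (projCoeff Z A eOut eIn θ γ k) e *
          (weight Z θ γ e * lin (Pi.single s 1) e) := by
      simp only [lin_eq_sum (projCoeff Z A eOut eIn θ γ k), mul_neg, Finset.sum_neg_distrib,
        Finset.mul_sum, Finset.sum_mul]
      rw [Finset.sum_comm]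
      congr 1
      refine Finset.sum_congr rfl fun e _ => Finset.sum_congr rfl fun s _ => by ring
    unfold projCoeff at h3
    rw [h3, neg_inj] at h2
    rw [← sub_eq_zero, ← Finset.sum_sub_distrib] at h2
    rw [← neg_eq_zero, ← Finset.sum_neg_distrib, ← h2]
    refine Finset.sum_congr rfl fun e _ => ?_
    unfold resid projCoeff
    ring
  simp only [lin_eq_sum x, Finset.mul_sum]
  rw [Finset.sum_comm]
  refine Finset.sum_eq_zero fun s _ => ?_
  rw [← mul_zero (x s), ← hsingle s, Finset.mul_sum]
  exact Finset.sum_congr rfl fun e _ => by ring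

/-- The Schur complement amounts to replacing one factor of the covariate Gram matrix by its
residual. -/
lemma H_apply (k l : Fin p) :
    H Z A eOut eIn θ γ k l =
      -∑ e : OffDiag n, weight Z θ γ e * resid Z A eOut eIn θ γ k e * Z e.1.1 e.1.2 l := by
  have h3 : ∑ s', projCoeff Z A eOut eIn θ γ k s' *
      -∑ e : OffDiag n, lin (Pi.single s' 1) e * (weight Z θ γ e * Z e.1.1 e.1.2 l) =
      -∑ e : OffDiag n, lin (projCoeff Z A eOut eIn θ γ k) e *
        (weight Z θ γ e * Z e.1.1 e.1.2 l) := by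
    simp only [lin_eq_sum (projCoeff Z A eOut eIn θ γ k), mul_neg, Finset.sum_neg_distrib,
      Finset.mul_sum, Finset.sum_mul]
    rw [Finset.sum_comm]
    congr 1
    refine Finset.sum_congr rfl fun e _ => Finset.sum_congr rfl fun s _ => by ring
  rw [H, Matrix.sub_apply, Matrix.mul_apply, jac_Q_gamma]
  simp only [jac_F_gamma]
  unfold projCoeff at h3
  rw [h3, sub_neg_eq_add, ← Finset.sum_neg_distrib, ← Finset.sum_neg_distrib,
    ← Finset.sum_add_distrib]
  refine Finset.sum_congr rfl fun e _ => ?_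
  unfold resid projCoeff
  ring

end Jacobians

end PrivateBeta

/-! ### Continuation, and global injectivity of the moment map. -/

namespace PrivateBeta

/-- A local homeomorphism along which solutions of `T x = (1 - s) T x₀ + s y` cannot leave the
compact set `K` attains the value `y` in `K`. -/
lemma exists_eq_of_a_priori {E : Type*} [NormedAddCommGroup E] [NormedSpace ℝ E] [CompleteSpace E]
    {T : E → E} (hT : ∀ x, ∃ T' : E →L[ℝ] E, HasStrictFDerivAt T T' x ∧ Function.Surjective T')
    {K : Set E} (hK : IsCompact K) {x₀ : E} (hx₀ : x₀ ∈ K) (y : E)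
    (hap : ∀ x ∈ K, ∀ s ∈ Set.Icc (0 : ℝ) 1, T x = T x₀ + s • (y - T x₀) → x ∈ interior K) :
    ∃ x ∈ K, T x = y := by
  have hTc : Continuous T := continuous_iff_continuousAt.2 fun x => by
    obtain ⟨T', h, _⟩ := hT x
    exact h.continuousAt
  have hpath : Continuous fun s : ℝ => T x₀ + s • (y - T x₀) := by fun_prop
  set S : Set ℝ := (fun s : ℝ => T x₀ + s • (y - T x₀)) ⁻¹' (T '' K) with hS
  -- Compactness of `K` makes the set of attained times closed.
  have hSc : IsClosed S := (hK.image hTc).isClosed.preimage hpath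
  have hsub : Set.Icc (0 : ℝ) 1 ⊆ S := by
    refine (hSc.inter isClosed_Icc).Icc_subset_of_forall_mem_nhdsWithin ?_ ?_
    · exact ⟨x₀, hx₀, by simp⟩
    · rintro s ⟨⟨x, hxK, hx⟩, hs⟩
      refine mem_nhdsWithin_of_mem_nhds (hpath.continuousAt.preimage_mem_nhds ?_)
      obtain ⟨T', h, hsurj⟩ := hT x
      -- A surjective strict derivative makes `T` open at `x`; as `x` is interior to `K`, nearby
      -- points of the path are attained in `K` as well.
      have hnhds := h.map_nhds_eq_of_surj (LinearMap.range_eq_top.2 hsurj)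
      have hxi := hap x hxK s ⟨hs.1, hs.2.le⟩ hx
      replace hx : T x = T x₀ + s • (y - T x₀) := hx
      change T '' K ∈ 𝓝 (T x₀ + s • (y - T x₀))
      rw [← hx, ← hnhds]
      exact image_mem_map (mem_interior_iff_mem_nhds.1 hxi)
  obtain ⟨x, hxK, hx⟩ := hsub ⟨zero_le_one, le_rfl⟩
  exact ⟨x, hxK, by simpa using hx⟩

variable {n p : ℕ}

lemma card_offDiag_le : (Fintype.card (OffDiag n) : ℝ) ≤ (n : ℝ) ^ 2 := by
  have h := Fintype.card_subtype_le fun e : Fin n × Fin n => e.1 ≠ e.2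
  rw [Fintype.card_prod, Fintype.card_fin] at h
  rw [sq]
  exact_mod_cast h

lemma sum_offDiag_le {f : OffDiag n → ℝ} {c : ℝ} (hc : 0 ≤ c) (hf : ∀ e, f e ≤ c) :
    ∑ e, f e ≤ (n : ℝ) ^ 2 * c := by
  refine (Finset.sum_le_card_nsmul _ _ c fun e _ => hf e).trans ?_
  rw [nsmul_eq_mul, Finset.card_univ]
  exact mul_le_mul_of_nonneg_right card_offDiag_le hc

lemma sum_filter_ne_le {f : Fin n → ℝ} {c : ℝ} (i : Fin n) (hf : ∀ j, j ≠ i → f j ≤ c) :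
    ∑ j ∈ Finset.univ.filter (fun j => j ≠ i), f j ≤ ((n : ℝ) - 1) * c := by
  refine (Finset.sum_le_card_nsmul _ _ c fun j hj => hf j (Finset.mem_filter.1 hj).2).trans ?_
  have : 1 ≤ n := i.pos
  simp [Finset.filter_ne', Finset.card_erase_of_mem, this]

section

variable (Z : Fin n → Fin n → Fin p → ℝ) (A : Fin n → Fin n → ℤ) (eOut eIn : Fin n → ℤ)

/-- The linear predictor as a continuous linear functional of `(θ, γ)`. -/
noncomputable def predMap (e : OffDiag n) : ((ThetaIdx n → ℝ) × (Fin p → ℝ)) →L[ℝ] ℝ :=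
  LinearMap.toContinuousLinearMap
    ((linMap e).comp (LinearMap.fst ℝ _ _) +
      (∑ k, Z e.1.1 e.1.2 k • LinearMap.proj (R := ℝ) (φ := fun _ : Fin p => ℝ) k).comp
        (LinearMap.snd ℝ _ _))

lemma predMap_apply (e : OffDiag n) (x : (ThetaIdx n → ℝ) × (Fin p → ℝ)) :
    predMap Z e x = lin x.1 e + ∑ k, Z e.1.1 e.1.2 k * x.2 k := by
  simp [predMap, linMap]

lemma linPred_eq_predMap (x : (ThetaIdx n → ℝ) × (Fin p → ℝ)) (e : OffDiag n) :
    linPred Z x.1 x.2 e.1.1 e.1.2 = predMap Z e x := by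
  rw [predMap_apply, linPred_eq]

lemma abs_sum_mul_le {q : ℝ} (hq : ∀ (e : OffDiag n) k, |Z e.1.1 e.1.2 k| ≤ q) (e : OffDiag n)
    (g : Fin p → ℝ) : |∑ k, Z e.1.1 e.1.2 k * g k| ≤ p * q * ‖g‖ := by
  refine (Finset.abs_sum_le_sum_abs _ _).trans ?_
  refine (Finset.sum_le_card_nsmul _ _ (q * ‖g‖) fun k _ => ?_).trans ?_
  · rw [abs_mul]
    exact mul_le_mul (hq e k) (norm_le_pi_norm g k) (abs_nonneg _) ((abs_nonneg _).trans (hq e k))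
  · simp [mul_assoc]

/-- The full system of moment equations. -/
noncomputable def momentMap (x : (ThetaIdx n → ℝ) × (Fin p → ℝ)) :
    (ThetaIdx n → ℝ) × (Fin p → ℝ) :=
  (F Z A eOut eIn x.1 x.2, Q Z A x.1 x.2)

lemma isMomentEstimate_iff (x : (ThetaIdx n → ℝ) × (Fin p → ℝ)) :
    IsMomentEstimate Z A eOut eIn x.1 x.2 ↔ momentMap Z A eOut eIn x = 0 := by
  rw [IsMomentEstimate, momentMap, Prod.mk_eq_zero]

/-- The moment equations tested against a full parameter vector. -/
lemma sum_mul_momentMap (x h : (ThetaIdx n → ℝ) × (Fin p → ℝ)) :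
    ∑ s, h.1 s * (momentMap Z A eOut eIn x).1 s + ∑ k, h.2 k * (momentMap Z A eOut eIn x).2 k =
      ∑ e : OffDiag n, predMap Z e h * ((A e.1.1 e.1.2 : ℝ) - logistic (predMap Z e x)) +
        (∑ i, alpha h.1 i * eOut i + ∑ j, beta h.1 j * eIn j) := by
  simp only [momentMap, sum_mul_F, Q, predMap_apply Z _ h, edgeProb, linPred_eq_predMap, add_mul,
    Finset.sum_add_distrib, Finset.mul_sum, Finset.sum_mul]
  rw [Finset.sum_comm (s := Finset.univ (α := Fin p))]
  have : ∀ (e : OffDiag n) (k : Fin p), h.2 k * (Z e.1.1 e.1.2 k *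
      ((A e.1.1 e.1.2 : ℝ) - logistic (predMap Z e x))) = Z e.1.1 e.1.2 k * h.2 k *
      ((A e.1.1 e.1.2 : ℝ) - logistic (predMap Z e x)) := fun e k => by ring
  simp only [this]
  ring

/-- The derivative of the moment map. -/
noncomputable def momentDeriv (x : (ThetaIdx n → ℝ) × (Fin p → ℝ)) :
    ((ThetaIdx n → ℝ) × (Fin p → ℝ)) →L[ℝ] ((ThetaIdx n → ℝ) × (Fin p → ℝ)) :=
  (ContinuousLinearMap.pi fun s => -∑ e : OffDiag n,
    (lin (Pi.single s 1) e * logisticDeriv (predMap Z e x)) • predMap Z e).prod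
  (ContinuousLinearMap.pi fun k => -∑ e : OffDiag n,
    (Z e.1.1 e.1.2 k * logisticDeriv (predMap Z e x)) • predMap Z e)

lemma hasStrictFDerivAt_sum_logistic (c a : OffDiag n → ℝ) (k : ℝ)
    (x : (ThetaIdx n → ℝ) × (Fin p → ℝ)) :
    HasStrictFDerivAt (fun y => ∑ e, c e * (a e - logistic (predMap Z e y)) + k)
      (-∑ e, (c e * logisticDeriv (predMap Z e x)) • predMap Z e) x := by
  have hl : ∀ t, HasStrictDerivAt logistic (logisticDeriv t) t := fun t => by
    refine hasStrictDerivAt_of_hasDerivAt_of_continuousAt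
      (Eventually.of_forall hasDerivAt_logistic) ?_
    exact (hasDerivAt_logisticDeriv t).continuousAt
  rw [← Finset.sum_neg_distrib]
  refine HasStrictFDerivAt.add_const _ (HasStrictFDerivAt.fun_sum fun e _ => ?_)
  have h1 := (hl (predMap Z e x)).comp_hasStrictFDerivAt x (predMap Z e).hasStrictFDerivAt
  refine ((h1.const_sub (a e)).const_mul (c e)).congr_fderiv ?_
  ext y <;> simp [mul_assoc]

lemma hasStrictFDerivAt_momentMap (x : (ThetaIdx n → ℝ) × (Fin p → ℝ)) :
    HasStrictFDerivAt (momentMap Z A eOut eIn) (momentDeriv Z x) x := by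
  refine HasStrictFDerivAt.prodMk ?_ ?_
  · refine hasStrictFDerivAt_pi.2 fun s => ?_
    simp only [F_apply, edgeProb, linPred_eq_predMap]
    exact hasStrictFDerivAt_sum_logistic Z _ _ _ x
  · refine hasStrictFDerivAt_pi.2 fun k => ?_
    simp only [Q, edgeProb, linPred_eq_predMap]
    have := hasStrictFDerivAt_sum_logistic Z (fun e => Z e.1.1 e.1.2 k)
      (fun e => A e.1.1 e.1.2) 0 x
    simpa only [add_zero] using this

lemma sum_mul_momentDeriv (x h : (ThetaIdx n → ℝ) × (Fin p → ℝ)) :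
    ∑ s, h.1 s * (momentDeriv Z x h).1 s + ∑ k, h.2 k * (momentDeriv Z x h).2 k =
      -∑ e : OffDiag n, logisticDeriv (predMap Z e x) * predMap Z e h ^ 2 := by
  have h1 : ∀ e, logisticDeriv (predMap Z e x) * predMap Z e h ^ 2 =
      ∑ s, h.1 s * (lin (Pi.single s 1) e * logisticDeriv (predMap Z e x) * predMap Z e h) +
      ∑ k, h.2 k * (Z e.1.1 e.1.2 k * logisticDeriv (predMap Z e x) * predMap Z e h) := by
    intro e
    rw [sq, ← mul_assoc]
    conv_lhs => rw [mul_comm]; arg 1; rw [predMap_apply, lin_eq_sum]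
    rw [add_mul, Finset.sum_mul, Finset.sum_mul]
    congr 1 <;> exact Finset.sum_congr rfl fun _ _ => by ring
  simp only [h1, Finset.sum_add_distrib]
  rw [Finset.sum_comm, Finset.sum_comm (t := Finset.univ (α := Fin p))]
  simp [momentDeriv, Finset.mul_sum]
  ring

/-- If all predictors of `h` vanish, its covariate part is minus a node effect, so `H` applied to
`h.2` is a pairing of residuals with node effects, which is zero. Thus `H` at one point tests the
rank of the design, whatever the weights. -/
lemma eq_zero_of_predMap_eq_zero (hn : 3 ≤ n) {θ : ThetaIdx n → ℝ} {γ : Fin p → ℝ}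
    (hH : IsUnit (H Z A eOut eIn θ γ).det) {h : (ThetaIdx n → ℝ) × (Fin p → ℝ)}
    (hh : ∀ e, predMap Z e h = 0) : h = 0 := by
  have h1 : Matrix.mulVec (H Z A eOut eIn θ γ) h.2 = 0 := by
    ext k
    rw [Pi.zero_apply, ← sum_weight_resid_lin Z A eOut eIn θ γ hn k h.1]
    simp only [Matrix.mulVec, dotProduct, H_apply, neg_mul, Finset.sum_neg_distrib, Finset.sum_mul]
    rw [Finset.sum_comm, ← Finset.sum_neg_distrib]
    refine Finset.sum_congr rfl fun e _ => ?_
    have h2 := hh e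
    rw [predMap_apply, add_eq_zero_iff_eq_neg] at h2
    rw [h2, mul_neg, Finset.mul_sum]
    congr 1
    exact Finset.sum_congr rfl fun _ _ => by ring
  have h2 : h.2 = 0 := by
    by_contra h0
    exact hH.ne_zero (Matrix.exists_mulVec_eq_zero_iff.1 ⟨h.2, h0, h1⟩)
  have h3 : h.1 = 0 := eq_zero_of_lin_eq_zero hn fun e => by
    have := hh e
    rw [predMap_apply, h2] at this
    simpa using this
  exact Prod.ext h3 h2

/-- A kernel vector annihilates the Gram form at `x`, hence all predictors. The point `x` is
unrelated to the point where `H` is invertible. -/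
lemma surjective_momentDeriv (hn : 3 ≤ n) {θ : ThetaIdx n → ℝ} {γ : Fin p → ℝ}
    (hH : IsUnit (H Z A eOut eIn θ γ).det) (x : (ThetaIdx n → ℝ) × (Fin p → ℝ)) :
    Function.Surjective (momentDeriv Z x) := by
  have hinj : Function.Injective (momentDeriv Z x).toLinearMap := by
    rw [← LinearMap.ker_eq_bot, LinearMap.ker_eq_bot']
    intro h hh
    have h1 := sum_mul_momentDeriv Z x h
    have h2 : momentDeriv Z x h = 0 := hh
    simp only [h2, Prod.fst_zero, Prod.snd_zero, Pi.zero_apply, mul_zero,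
      Finset.sum_const_zero, add_zero] at h1
    have h3 := (Finset.sum_eq_zero_iff_of_nonneg fun e _ =>
      mul_nonneg (logisticDeriv_pos (predMap Z e x)).le (sq_nonneg (predMap Z e h))).1
      (neg_eq_zero.1 h1.symm)
    refine eq_zero_of_predMap_eq_zero Z A eOut eIn hn hH fun e => ?_
    simpa [(logisticDeriv_pos (predMap Z e x)).ne'] using h3 e (Finset.mem_univ e)
  exact LinearMap.injective_iff_surjective.1 hinj

/-- Testing the difference of the equations against `x - y` gives a vanishing sum of nonnegative
terms, by monotonicity of the logistic function. -/
lemma momentMap_injective (hn : 3 ≤ n) {θ : ThetaIdx n → ℝ} {γ : Fin p → ℝ}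
    (hH : IsUnit (H Z A eOut eIn θ γ).det) : Function.Injective (momentMap Z A eOut eIn) := by
  intro x y hxy
  have h1 := sum_mul_momentMap Z A eOut eIn x (x - y)
  rw [hxy, sum_mul_momentMap, add_left_inj, ← sub_eq_zero, ← Finset.sum_sub_distrib] at h1
  have hmono : ∀ a b : ℝ, 0 ≤ (a - b) * (logistic a - logistic b) := fun a b => by
    rcases le_total a b with h | h
    · exact mul_nonneg_of_nonpos_of_nonpos (sub_nonpos.2 h)
        (sub_nonpos.2 (logistic_strictMono.monotone h))
    · exact mul_nonneg (sub_nonneg.2 h) (sub_nonneg.2 (logistic_strictMono.monotone h))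
  have h2 : ∑ e, (predMap Z e x - predMap Z e y) *
      (logistic (predMap Z e x) - logistic (predMap Z e y)) = 0 := by
    rw [← h1]
    refine Finset.sum_congr rfl fun e _ => ?_
    rw [map_sub]; ring
  have h3 := (Finset.sum_eq_zero_iff_of_nonneg fun e _ => hmono _ _).1 h2
  refine sub_eq_zero.1 (eq_zero_of_predMap_eq_zero Z A eOut eIn hn hH fun e => ?_)
  rw [map_sub]
  rcases mul_eq_zero.1 (h3 e (Finset.mem_univ e)) with h | h
  · exact h
  · rw [logistic_strictMono.injective (sub_eq_zero.1 h), sub_self]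

end

end PrivateBeta

/-! ### A priori bounds and the deterministic core. -/

namespace PrivateBeta

variable {n p : ℕ}

/-- The contribution of the noise to the moment equations tested against `w`. -/
noncomputable def noisePairing (eOut eIn : Fin n → ℤ) (w : ThetaIdx n → ℝ) : ℝ :=
  ∑ i, alpha w i * eOut i + ∑ j, beta w j * eIn j

/-- The noise of the in-degree of node `j`; for the last node it is the discrepancy between the
noises of the released out-degrees and of the released in-degrees. -/
noncomputable def inNoise (eOut eIn : Fin n → ℤ) (j : Fin n) : ℝ :=
  if (j : ℕ) < n - 1 then (eIn j : ℝ) else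
    ∑ i, (eOut i : ℝ) - ∑ j' : Fin n, if (j' : ℕ) < n - 1 then (eIn j' : ℝ) else 0

section

variable (Z : Fin n → Fin n → Fin p → ℝ) (A : Fin n → Fin n → ℤ) (eOut eIn : Fin n → ℤ)
  (θs : ThetaIdx n → ℝ) (γs : Fin p → ℝ)

/-- Orthogonality makes all weighted row and column sums of the residual vanish. The coefficients
therefore solve a bipartite system whose right-hand side, a weighted covariate sum, is at most `(n -
1) * q / 4`. -/
lemma norm_projCoeff_le {m q : ℝ} (hn : 3 ≤ n) (hm : 0 < m) (hmn : 1 ≤ m * (n - 1))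
    (hq0 : 0 ≤ q) (hmw : ∀ e, m ≤ weight Z θs γs e)
    (hq : ∀ (e : OffDiag n) k, |Z e.1.1 e.1.2 k| ≤ q) (k : Fin p) :
    ‖projCoeff Z A eOut eIn θs γs k‖ ≤ q / (4 * m ^ 2) := by
  set w := projCoeff Z A eOut eIn θs γs k with hw
  set v : Fin n → Fin n → ℝ := fun i j => logisticDeriv (linPred Z θs γs i j)
  have hN : (0 : ℝ) < n - 1 := by
    have : (3 : ℝ) ≤ n := by exact_mod_cast hn
    linarith
  have e₀ : OffDiag n := ⟨(⟨0, by omega⟩, ⟨1, by omega⟩), by simp⟩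
  have h1 := row_col_sum_of_lin_pairing
    (y := fun i j => v i j * (Z i j k - (alpha w i + beta w j))) (f := 0) (h := 0) (by
      intro x
      simp only [Pi.zero_apply, mul_zero, Finset.sum_const_zero, add_zero]
      rw [← sum_weight_resid_lin Z A eOut eIn θs γs hn k x]
      refine Finset.sum_congr rfl fun e _ => ?_
      rw [mul_comm]; rfl)
  obtain ⟨hrow, hcol⟩ := h1
  simp only [Pi.zero_apply, ite_self, Finset.sum_const_zero, sub_zero] at hrow hcol
  have hvZ : ∀ i j, i ≠ j → |v i j * Z i j k| ≤ q / 4 := fun i j hij => by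
    have h1 := weight_le Z θs γs ⟨(i, j), hij⟩
    have h2 := weight_pos Z θs γs ⟨(i, j), hij⟩
    have h3 := hq ⟨(i, j), hij⟩ k
    change logisticDeriv (linPred Z θs γs i j) ≤ _ at h1
    change 0 < logisticDeriv (linPred Z θs γs i j) at h2
    rw [abs_mul, abs_of_pos h2]
    calc v i j * |Z i j k| ≤ 1 / 4 * q := mul_le_mul h1 h3 (abs_nonneg _) (by norm_num)
      _ = q / 4 := by ring
  obtain ⟨l, hl⟩ := exists_beta_eq_zero (n := n) (by omega)
  have key := abs_le_of_weighted_sums (v := v) (a := alpha w) (b := beta w)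
    (M := 1 / 4) (δ := (n - 1) * (q / 4)) hm (by positivity)
    ((hmw e₀).trans (weight_le Z θs γs e₀)) (by linarith)
    (fun i j hij => ⟨hmw ⟨(i, j), hij⟩, weight_le Z θs γs ⟨(i, j), hij⟩⟩)
    (fun i => by
      have h1 := hrow i
      simp only [mul_sub, Finset.sum_sub_distrib] at h1
      rw [← sub_eq_zero.1 h1]
      exact (Finset.abs_sum_le_sum_abs _ _).trans
        (sum_filter_ne_le i fun j hj => hvZ i j hj.symm))
    (fun j => by
      have h1 := hcol j
      simp only [mul_sub, Finset.sum_sub_distrib] at h1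
      rw [← sub_eq_zero.1 h1]
      exact (Finset.abs_sum_le_sum_abs _ _).trans
        (sum_filter_ne_le j fun i hi => hvZ i j hi)) (hl w)
  have e : 4 * (1 / 4 * ((n - 1 : ℝ) * (q / 4)) / (m ^ 2 * (n - 1))) = q / (4 * m ^ 2) := by
    field_simp
  rw [e] at key
  exact norm_le_of_alpha_beta (by positivity) key.1 key.2

lemma abs_resid_le {m q : ℝ} (hn : 3 ≤ n) (hm : 0 < m) (hmn : 1 ≤ m * (n - 1))
    (hq0 : 0 ≤ q) (hmw : ∀ e, m ≤ weight Z θs γs e)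
    (hq : ∀ (e : OffDiag n) k, |Z e.1.1 e.1.2 k| ≤ q) (k : Fin p) (e : OffDiag n) :
    |resid Z A eOut eIn θs γs k e| ≤ q / m ^ 2 := by
  have h1 := norm_projCoeff_le Z A eOut eIn θs γs hn hm hmn hq0 hmw hq k
  have h2 := abs_lin_le (projCoeff Z A eOut eIn θs γs k) e
  have h3 := hq e k
  have h4 : m ≤ 1 / 4 := (hmw e).trans (weight_le _ _ _ _)
  have h5 : q ≤ q / (2 * m ^ 2) := by
    rw [le_div_iff₀ (by positivity)]
    exact mul_le_of_le_one_right hq0 (by nlinarith)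
  have h6 := abs_sub (Z e.1.1 e.1.2 k) (lin (projCoeff Z A eOut eIn θs γs k) e)
  have h7 : q / m ^ 2 = q / (2 * m ^ 2) + 2 * (q / (4 * m ^ 2)) := by field_simp; ring
  unfold resid
  linarith

/-- A projection does not increase the weighted norm, so no power of `1 / m` appears, unlike in the
pointwise bound `abs_resid_le`. -/
lemma abs_H_apply_le {q : ℝ} (hn : 3 ≤ n)
    (hq : ∀ (e : OffDiag n) k, |Z e.1.1 e.1.2 k| ≤ q) (k l : Fin p) :
    |H Z A eOut eIn θs γs k l| ≤ (n : ℝ) ^ 2 * (q ^ 2 / 4) := by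
  set r := resid Z A eOut eIn θs γs k with hr
  set v := weight Z θs γs with hv
  have hZ : ∀ k, ∑ e : OffDiag n, v e * Z e.1.1 e.1.2 k ^ 2 ≤ (n : ℝ) ^ 2 * (q ^ 2 / 4) := by
    intro k
    refine sum_offDiag_le (by positivity) fun e => ?_
    have h1 : Z e.1.1 e.1.2 k ^ 2 ≤ q ^ 2 := sq_le_sq' (neg_le_of_abs_le (hq e k))
      (le_of_abs_le (hq e k))
    have h2 := weight_le Z θs γs e
    calc v e * Z e.1.1 e.1.2 k ^ 2 ≤ 1 / 4 * q ^ 2 := mul_le_mul h2 h1 (sq_nonneg _) (by norm_num)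
      _ = q ^ 2 / 4 := by ring
  -- The residual is orthogonal to `Z - r`, which is a node effect.
  have hrr : ∑ e, v e * r e ^ 2 = ∑ e : OffDiag n, v e * r e * Z e.1.1 e.1.2 k := by
    rw [← sub_eq_zero, ← neg_eq_zero, ← Finset.sum_sub_distrib, ← Finset.sum_neg_distrib,
      ← sum_weight_resid_lin Z A eOut eIn θs γs hn k (projCoeff Z A eOut eIn θs γs k)]
    refine Finset.sum_congr rfl fun e _ => ?_
    rw [← hr, ← hv]
    have : lin (projCoeff Z A eOut eIn θs γs k) e = Z e.1.1 e.1.2 k - r e := by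
      rw [hr, resid]; ring
    rw [this]; ring
  have habs : ∀ l, |∑ e : OffDiag n, v e * r e * Z e.1.1 e.1.2 l| ≤
      (∑ e, v e * r e ^ 2 + ∑ e : OffDiag n, v e * Z e.1.1 e.1.2 l ^ 2) / 2 := by
    intro l
    rw [← Finset.sum_add_distrib, Finset.sum_div]
    refine (Finset.abs_sum_le_sum_abs _ _).trans (Finset.sum_le_sum fun e _ => ?_)
    have hv0 := (weight_pos Z θs γs e).le
    rw [mul_assoc, abs_mul, abs_of_nonneg hv0, ← mul_add, mul_div_assoc]
    refine mul_le_mul_of_nonneg_left (abs_le.2 ⟨?_, ?_⟩) hv0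
    · nlinarith [sq_nonneg (r e + Z e.1.1 e.1.2 l)]
    · nlinarith [sq_nonneg (r e - Z e.1.1 e.1.2 l)]
  have h1 := habs k
  rw [← hrr] at h1
  have h2 := le_of_abs_le h1
  have h3 := habs l
  rw [H_apply, abs_neg]
  linarith [hZ k, hZ l]

lemma linftyNorm_eq_one_le {M N : Matrix (Fin p) (Fin p) ℝ} (hp : 0 < p) (h : M * N = 1) :
    1 ≤ linftyNorm M * linftyNorm N := by
  let _ : NormedRing (Matrix (Fin p) (Fin p) ℝ) := Matrix.linftyOpNormedRing
  have : Nonempty (Fin p) := ⟨⟨0, hp⟩⟩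
  have : NormOneClass (Matrix (Fin p) (Fin p) ℝ) := Matrix.linfty_opNormOneClass
  have h1 : ‖M * N‖ ≤ ‖M‖ * ‖N‖ := norm_mul_le M N
  rw [h, norm_one] at h1
  exact h1

lemma norm_mulVec_le_linftyNorm (M : Matrix (Fin p) (Fin p) ℝ) (x : Fin p → ℝ) :
    ‖Matrix.mulVec M x‖ ≤ linftyNorm M * ‖x‖ := by
  let _ : NormedAddCommGroup (Matrix (Fin p) (Fin p) ℝ) := Matrix.linftyOpNormedAddCommGroup
  exact Matrix.linfty_opNorm_mulVec M x

lemma linftyNorm_le {M : Matrix (Fin p) (Fin p) ℝ} {c : ℝ} (hc : 0 ≤ c)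
    (hM : ∀ k l, |M k l| ≤ c) : linftyNorm M ≤ p * c := by
  let _ : NormedAddCommGroup (Matrix (Fin p) (Fin p) ℝ) := Matrix.linftyOpNormedAddCommGroup
  change ‖M‖ ≤ _
  rw [Matrix.linfty_opNorm_def]
  lift c to NNReal using hc
  have : (Finset.univ : Finset (Fin p)).sup (fun i => ∑ j, ‖M i j‖₊) ≤ p * c := by
    refine Finset.sup_le fun i _ => ?_
    refine (Finset.sum_le_card_nsmul _ _ c fun j _ => ?_).trans (by simp)
    exact_mod_cast hM i j
  exact_mod_cast this

/-- The size of the covariates limits how well conditioned `H` can be. -/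
lemma four_le_of_linftyNorm_inv_le {q lam : ℝ} (hp : 0 < p) (hn : 3 ≤ n)
    (hq : ∀ (e : OffDiag n) k, |Z e.1.1 e.1.2 k| ≤ q)
    (hH : IsUnit (H Z A eOut eIn θs γs).det)
    (hHn : linftyNorm (H Z A eOut eIn θs γs)⁻¹ ≤ lam / (n : ℝ) ^ 2) :
    4 ≤ lam * (p * q ^ 2) := by
  have h1 := linftyNorm_eq_one_le hp (Matrix.nonsing_inv_mul _ hH)
  have h2 := linftyNorm_le (by positivity) (abs_H_apply_le Z A eOut eIn θs γs hn hq)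
  have h0 : ∀ M : Matrix (Fin p) (Fin p) ℝ, 0 ≤ linftyNorm M := fun M =>
    @norm_nonneg _ (Matrix.linftyOpNormedAddCommGroup.toSeminormedAddCommGroup.toSeminormedAddGroup) M
  have h3 : 1 ≤ lam / (n : ℝ) ^ 2 * (p * ((n : ℝ) ^ 2 * (q ^ 2 / 4))) :=
    h1.trans (mul_le_mul hHn h2 (h0 _) ((h0 _).trans hHn))
  have hn0 : (n : ℝ) ≠ 0 := by positivity
  have h4 : lam / (n : ℝ) ^ 2 * (p * ((n : ℝ) ^ 2 * (q ^ 2 / 4))) = lam * (p * q ^ 2) / 4 := by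
    field_simp
  linarith

/-- A priori bound for the node parameters along the homotopy. -/
lemma norm_theta_sub_le {m q D s : ℝ} (hn : 3 ≤ n) (hm : 0 < m) (hmn : 1 ≤ m * (n - 1))
    (hq0 : 0 ≤ q)
    (hmw : ∀ (e : OffDiag n) (t : ℝ), |t - linPred Z θs γs e.1.1 e.1.2| ≤ 1 → m ≤ logisticDeriv t)
    (hq : ∀ (e : OffDiag n) k, |Z e.1.1 e.1.2 k| ≤ q)
    (hrowD : ∀ i, |∑ j ∈ Finset.univ.filter (fun j => j ≠ i),
      ((A i j : ℝ) - edgeProb Z θs γs i j) + eOut i| ≤ D)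
    (hcolD : ∀ j, |∑ i ∈ Finset.univ.filter (fun i => i ≠ j),
      ((A i j : ℝ) - edgeProb Z θs γs i j) + inNoise eOut eIn j| ≤ D)
    (hs : s ∈ Set.Icc (0 : ℝ) 1) {θ : ThetaIdx n → ℝ} {γ : Fin p → ℝ}
    (hbox : 2 * ‖θ - θs‖ + p * q * ‖γ - γs‖ ≤ 1)
    (hF : F Z A eOut eIn θ γ = (1 - s) • F Z A eOut eIn θs γs) :
    ‖θ - θs‖ ≤ (D + (n - 1) * (p * q * ‖γ - γs‖ / 4)) / (m ^ 2 * (n - 1)) := by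
  set Δ := θ - θs with hΔ
  set Γ := γ - γs with hΓ
  have hN : (0 : ℝ) < n - 1 := by
    have : (3 : ℝ) ≤ n := by exact_mod_cast hn
    linarith
  have e₀ : OffDiag n := ⟨(⟨0, by omega⟩, ⟨1, by omega⟩), by simp⟩
  have i₀ : Fin n := ⟨0, by omega⟩
  have hD : 0 ≤ D := (abs_nonneg _).trans (hrowD i₀)
  have hdiff : ∀ i j : Fin n, linPred Z θ γ i j - linPred Z θs γs i j =
      (alpha Δ i + beta Δ j) + ∑ k, Z i j k * Γ k := by
    intro i j
    have hb : beta θ j = beta Δ j + beta θs j := by rw [← beta_add, hΔ, sub_add_cancel]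
    have ha : alpha θ i = alpha Δ i + alpha θs i := by rw [← alpha_add, hΔ, sub_add_cancel]
    simp only [linPred, hb, ha, hΓ, Pi.sub_apply, mul_sub, Finset.sum_sub_distrib]
    ring
  -- Intermediate points turn the equations into a linear system; the box keeps `ξ` within 1 of the
  -- true predictor, so the weights stay above `m`.
  choose ξ hξ1 hξ2 using fun i j =>
    exists_logistic_sub_eq (linPred Z θs γs i j) (linPred Z θ γ i j)
  set v : Fin n → Fin n → ℝ := fun i j => logisticDeriv (ξ i j) with hv
  have hvm : ∀ i j, i ≠ j → m ≤ v i j ∧ v i j ≤ 1 / 4 := by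
    intro i j hij
    refine ⟨hmw ⟨(i, j), hij⟩ _ ((hξ1 i j).trans ?_), logisticDeriv_le _⟩
    rw [hdiff]
    have h1 := abs_lin_le Δ ⟨(i, j), hij⟩
    have h2 := abs_sum_mul_le Z hq ⟨(i, j), hij⟩ Γ
    exact (abs_add_le _ _).trans ((add_le_add h1 h2).trans hbox)
  have hvZ : ∀ i j, i ≠ j → |v i j * ∑ k, Z i j k * Γ k| ≤ p * q * ‖Γ‖ / 4 := fun i j hij => by
    have h1 := abs_sum_mul_le Z hq ⟨(i, j), hij⟩ Γ
    rw [abs_mul, abs_of_pos (hm.trans_le (hvm i j hij).1)]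
    calc v i j * |∑ k, Z i j k * Γ k| ≤ 1 / 4 * (p * q * ‖Γ‖) :=
          mul_le_mul (hvm i j hij).2 h1 (abs_nonneg _) (by norm_num)
      _ = p * q * ‖Γ‖ / 4 := by ring
  -- the equations, tested against an arbitrary vector
  obtain ⟨hrow, hcol⟩ := row_col_sum_of_lin_pairing
    (y := fun i j => edgeProb Z θ γ i j - edgeProb Z θs γs i j -
      s * ((A i j : ℝ) - edgeProb Z θs γs i j))
    (f := fun i => s * eOut i) (h := fun j => s * eIn j) (by
      intro w
      have h1 := sum_mul_F Z A eOut eIn θ γ w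
      have h2 := sum_mul_F Z A eOut eIn θs γs w
      have h3 : ∑ s, w s * F Z A eOut eIn θ γ s =
          (1 - s) * ∑ s, w s * F Z A eOut eIn θs γs s := by
        rw [hF, Finset.mul_sum]
        exact Finset.sum_congr rfl fun _ _ => by simp; ring
      rw [h1, h2] at h3
      have h4 : ∑ e : OffDiag n, lin w e * (edgeProb Z θ γ e.1.1 e.1.2 -
          edgeProb Z θs γs e.1.1 e.1.2 -
          s * ((A e.1.1 e.1.2 : ℝ) - edgeProb Z θs γs e.1.1 e.1.2)) =
          (1 - s) * ∑ e : OffDiag n, lin w e *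
            ((A e.1.1 e.1.2 : ℝ) - edgeProb Z θs γs e.1.1 e.1.2) -
          ∑ e : OffDiag n, lin w e * ((A e.1.1 e.1.2 : ℝ) - edgeProb Z θ γ e.1.1 e.1.2) := by
        rw [Finset.mul_sum, ← Finset.sum_sub_distrib]
        exact Finset.sum_congr rfl fun _ _ => by ring
      have h5 : ∑ i, alpha w i * (s * (eOut i : ℝ)) = s * ∑ i, alpha w i * (eOut i : ℝ) := by
        rw [Finset.mul_sum]; exact Finset.sum_congr rfl fun _ _ => by ring
      have h6 : ∑ i, beta w i * (s * (eIn i : ℝ)) = s * ∑ i, beta w i * (eIn i : ℝ) := by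
        rw [Finset.mul_sum]; exact Finset.sum_congr rfl fun _ _ => by ring
      rw [h4, h5, h6]
      linarith)
  have hy : ∀ i j, v i j * (alpha Δ i + beta Δ j) =
      (edgeProb Z θ γ i j - edgeProb Z θs γs i j -
        s * ((A i j : ℝ) - edgeProb Z θs γs i j)) +
      s * ((A i j : ℝ) - edgeProb Z θs γs i j) - v i j * ∑ k, Z i j k * Γ k := by
    intro i j
    have h1 := hξ2 i j
    rw [hdiff] at h1
    simp only [edgeProb, hv]
    rw [h1]; ring
  have hsD : ∀ x : ℝ, |x| ≤ D → |s * x| ≤ D := fun x hx => by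
    rw [abs_mul, abs_of_nonneg hs.1]
    exact (mul_le_of_le_one_left (abs_nonneg _) hs.2).trans hx
  obtain ⟨l, hl⟩ := exists_beta_eq_zero (n := n) (by omega)
  have key := abs_le_of_weighted_sums (v := v) (a := alpha Δ) (b := beta Δ)
    (M := 1 / 4) (δ := D + (n - 1) * (p * q * ‖Γ‖ / 4)) hm (by positivity)
    ((hvm _ _ e₀.2).1.trans (hvm _ _ e₀.2).2) (by linarith) hvm
    (fun i => by
      simp only [hy, Finset.sum_add_distrib, Finset.sum_sub_distrib, hrow i, ← Finset.mul_sum]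
      have h1 := hsD _ (hrowD i)
      have h2 := (Finset.abs_sum_le_sum_abs _ _).trans
        (sum_filter_ne_le i fun j hj => hvZ i j (Ne.symm hj))
      simp only [Finset.sum_sub_distrib] at h1
      rw [← mul_add, add_comm (eOut i : ℝ)]
      exact (abs_sub _ _).trans (add_le_add h1 h2))
    (fun j => by
      have h1 := hsD _ (hcolD j)
      have h2 := (Finset.abs_sum_le_sum_abs _ _).trans
        (sum_filter_ne_le j fun i hi => hvZ i j hi)
      have h3 := hcol j
      -- The column of the last node has no equation; its noise is the one implied by all the
      -- others.
      have h4 : (if (j : ℕ) < n - 1 then s * (eIn j : ℝ) else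
          ∑ i, s * (eOut i : ℝ) - ∑ j' : Fin n, if (j' : ℕ) < n - 1 then s * (eIn j' : ℝ) else 0) =
          s * inNoise eOut eIn j := by
        unfold inNoise
        split_ifs
        · rfl
        · rw [mul_sub, Finset.mul_sum, Finset.mul_sum]
          simp only [mul_ite, mul_zero]
      rw [h4] at h3
      simp only [Finset.sum_sub_distrib, ← Finset.mul_sum] at h1 h3
      simp only [hy, Finset.sum_add_distrib, Finset.sum_sub_distrib, ← Finset.mul_sum]
      rw [h3, ← mul_add, add_comm (inNoise eOut eIn j)]
      exact (abs_sub _ _).trans (add_le_add h1 h2)) (hl Δ)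
  have e : 4 * (1 / 4 * (D + (n - 1 : ℝ) * (p * q * ‖Γ‖ / 4)) / (m ^ 2 * (n - 1))) =
      (D + (n - 1) * (p * q * ‖Γ‖ / 4)) / (m ^ 2 * (n - 1)) := by
    ring
  rw [e] at key
  exact norm_le_of_alpha_beta (by positivity) key.1 key.2

/-- A priori bound for the covariate parameters along the homotopy. -/
lemma norm_gamma_sub_le {m q G lam s : ℝ} (hn : 3 ≤ n) (hm : 0 < m) (hmn : 1 ≤ m * (n - 1))
    (hq0 : 0 ≤ q) (hG0 : 0 ≤ G) (hmw : ∀ e, m ≤ weight Z θs γs e)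
    (hq : ∀ (e : OffDiag n) k, |Z e.1.1 e.1.2 k| ≤ q)
    (hG : ∀ k, |∑ e : OffDiag n, resid Z A eOut eIn θs γs k e *
      ((A e.1.1 e.1.2 : ℝ) - edgeProb Z θs γs e.1.1 e.1.2) -
      noisePairing eOut eIn (projCoeff Z A eOut eIn θs γs k)| ≤ G)
    (hH : IsUnit (H Z A eOut eIn θs γs).det)
    (hHn : linftyNorm (H Z A eOut eIn θs γs)⁻¹ ≤ lam / (n : ℝ) ^ 2)
    (hs : s ∈ Set.Icc (0 : ℝ) 1) {θ : ThetaIdx n → ℝ} {γ : Fin p → ℝ}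
    (hF : F Z A eOut eIn θ γ = (1 - s) • F Z A eOut eIn θs γs)
    (hQ : Q Z A θ γ = (1 - s) • Q Z A θs γs) :
    ‖γ - γs‖ ≤ lam / (n : ℝ) ^ 2 * (G + (n : ℝ) ^ 2 * (q / m ^ 2 *
      ((2 * ‖θ - θs‖ + p * q * ‖γ - γs‖) ^ 2 / 4))) := by
  set Δ := θ - θs with hΔ
  set Γ := γ - γs with hΓ
  set u := 2 * ‖Δ‖ + p * q * ‖Γ‖ with hu
  set w := projCoeff Z A eOut eIn θs γs with hw
  set r := resid Z A eOut eIn θs γs with hr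
  have hdiff : ∀ e : OffDiag n, linPred Z θ γ e.1.1 e.1.2 - linPred Z θs γs e.1.1 e.1.2 =
      lin Δ e + ∑ k, Z e.1.1 e.1.2 k * Γ k := by
    intro e
    rw [linPred_eq, linPred_eq, hΔ, lin_sub, hΓ]
    simp only [Pi.sub_apply, mul_sub, Finset.sum_sub_distrib]
    ring
  have hHΓ : ∀ k, |Matrix.mulVec (H Z A eOut eIn θs γs) Γ k| ≤
      G + (n : ℝ) ^ 2 * (q / m ^ 2 * (u ^ 2 / 4)) := by
    intro k
    -- the profiled covariate equation
    have hprof : ∀ θ γ, Q Z A θ γ k - ∑ s, w k s * F Z A eOut eIn θ γ s =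
        ∑ e, r k e * ((A e.1.1 e.1.2 : ℝ) - edgeProb Z θ γ e.1.1 e.1.2) -
          noisePairing eOut eIn (w k) := by
      intro θ γ
      rw [sum_mul_F, Q, noisePairing, ← sub_sub, ← Finset.sum_sub_distrib]
      congr 1
      refine Finset.sum_congr rfl fun e _ => ?_
      rw [hr, resid]; ring
    have h1 : Q Z A θ γ k - ∑ s, w k s * F Z A eOut eIn θ γ s =
        (1 - s) * (Q Z A θs γs k - ∑ s, w k s * F Z A eOut eIn θs γs s) := by
      rw [hF, hQ, mul_sub, Finset.mul_sum]
      congr 1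
      exact Finset.sum_congr rfl fun _ _ => by simp; ring
    rw [hprof, hprof] at h1
    have h2 : ∑ e, r k e * (edgeProb Z θ γ e.1.1 e.1.2 - edgeProb Z θs γs e.1.1 e.1.2) =
        s * (∑ e, r k e * ((A e.1.1 e.1.2 : ℝ) - edgeProb Z θs γs e.1.1 e.1.2) -
          noisePairing eOut eIn (w k)) := by
      have h3 : ∑ e, r k e * (edgeProb Z θ γ e.1.1 e.1.2 - edgeProb Z θs γs e.1.1 e.1.2) =
          ∑ e, r k e * ((A e.1.1 e.1.2 : ℝ) - edgeProb Z θs γs e.1.1 e.1.2) -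
          ∑ e, r k e * ((A e.1.1 e.1.2 : ℝ) - edgeProb Z θ γ e.1.1 e.1.2) := by
        rw [← Finset.sum_sub_distrib]; exact Finset.sum_congr rfl fun _ _ => by ring
      rw [h3]; linarith
    -- By orthogonality `lin Δ` may be added at no cost; the bracket becomes the full change of the
    -- predictor, ready for Taylor expansion.
    have h4 : Matrix.mulVec (H Z A eOut eIn θs γs) Γ k =
        -∑ e, r k e * (weight Z θs γs e * (lin Δ e + ∑ l, Z e.1.1 e.1.2 l * Γ l)) := by
      have h5 := sum_weight_resid_lin Z A eOut eIn θs γs hn k Δ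
      have h6 : ∑ e, r k e * (weight Z θs γs e * (lin Δ e + ∑ l, Z e.1.1 e.1.2 l * Γ l)) =
          ∑ e, weight Z θs γs e * r k e * lin Δ e +
          ∑ e, weight Z θs γs e * r k e * ∑ l, Z e.1.1 e.1.2 l * Γ l := by
        rw [← Finset.sum_add_distrib]; exact Finset.sum_congr rfl fun _ _ => by ring
      rw [h6, h5, zero_add]
      simp only [Matrix.mulVec, dotProduct, H_apply, neg_mul, Finset.sum_neg_distrib,
        Finset.sum_mul, Finset.mul_sum]
      rw [Finset.sum_comm]
      congr 1
      exact Finset.sum_congr rfl fun _ _ => Finset.sum_congr rfl fun _ _ => by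
        rw [← hr]; ring
    have h7 : Matrix.mulVec (H Z A eOut eIn θs γs) Γ k =
        ∑ e, r k e * (edgeProb Z θ γ e.1.1 e.1.2 - edgeProb Z θs γs e.1.1 e.1.2 -
          weight Z θs γs e * (lin Δ e + ∑ l, Z e.1.1 e.1.2 l * Γ l)) -
        s * (∑ e, r k e * ((A e.1.1 e.1.2 : ℝ) - edgeProb Z θs γs e.1.1 e.1.2) -
          noisePairing eOut eIn (w k)) := by
      rw [← h2, h4, ← Finset.sum_sub_distrib, ← Finset.sum_neg_distrib]
      exact Finset.sum_congr rfl fun _ _ => by ring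
    rw [h7, add_comm G]
    refine (abs_sub _ _).trans (add_le_add ?_ ?_)
    · refine (Finset.abs_sum_le_sum_abs _ _).trans (sum_offDiag_le (by positivity) fun e => ?_)
      rw [abs_mul]
      refine mul_le_mul (abs_resid_le Z A eOut eIn θs γs hn hm hmn hq0 hmw hq k e) ?_
        (abs_nonneg _) (by positivity)
      have h8 := abs_logistic_taylor_le (linPred Z θs γs e.1.1 e.1.2) (linPred Z θ γ e.1.1 e.1.2)
      rw [hdiff] at h8
      refine h8.trans ?_
      have h9 : |lin Δ e + ∑ k, Z e.1.1 e.1.2 k * Γ k| ≤ u :=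
        (abs_add_le _ _).trans (add_le_add (abs_lin_le Δ e) (abs_sum_mul_le Z hq e Γ))
      have h10 := sq_le_sq' (neg_le_of_abs_le h9) (le_of_abs_le h9)
      linarith
    · rw [abs_mul, abs_of_nonneg hs.1]
      exact (mul_le_of_le_one_left (abs_nonneg _) hs.2).trans (hG k)
  have h1 : Matrix.mulVec (H Z A eOut eIn θs γs)⁻¹
      (Matrix.mulVec (H Z A eOut eIn θs γs) Γ) = Γ := by
    rw [Matrix.mulVec_mulVec, Matrix.nonsing_inv_mul _ hH, Matrix.one_mulVec]
  have h2 := norm_mulVec_le_linftyNorm (H Z A eOut eIn θs γs)⁻¹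
      (Matrix.mulVec (H Z A eOut eIn θs γs) Γ)
  rw [h1] at h2
  have h3 : ‖Matrix.mulVec (H Z A eOut eIn θs γs) Γ‖ ≤
      G + (n : ℝ) ^ 2 * (q / m ^ 2 * (u ^ 2 / 4)) :=
    (pi_norm_le_iff_of_nonneg (by positivity)).2 hHΓ
  have h0 : 0 ≤ linftyNorm (H Z A eOut eIn θs γs)⁻¹ :=
    @norm_nonneg _ (Matrix.linftyOpNormedAddCommGroup.toSeminormedAddCommGroup.toSeminormedAddGroup) _
  exact h2.trans (mul_le_mul hHn h3 (norm_nonneg _) (h0.trans hHn))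

/-- Deterministic core: small residuals at the true parameters force the existence of a moment
estimate, and every moment estimate is close to the true parameters. -/
theorem exists_and_forall_momentEstimate {m q D G lam r g : ℝ} (hn : 3 ≤ n) (hm : 0 < m)
    (hmn : 1 ≤ m * (n - 1)) (hq0 : 0 ≤ q) (hG0 : 0 ≤ G) (hlam : 0 ≤ lam)
    (hmw : ∀ (e : OffDiag n) (t : ℝ), |t - linPred Z θs γs e.1.1 e.1.2| ≤ 1 → m ≤ logisticDeriv t)
    (hq : ∀ (e : OffDiag n) k, |Z e.1.1 e.1.2 k| ≤ q)
    (hrowD : ∀ i, |∑ j ∈ Finset.univ.filter (fun j => j ≠ i),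
      ((A i j : ℝ) - edgeProb Z θs γs i j) + eOut i| ≤ D)
    (hcolD : ∀ j, |∑ i ∈ Finset.univ.filter (fun i => i ≠ j),
      ((A i j : ℝ) - edgeProb Z θs γs i j) + inNoise eOut eIn j| ≤ D)
    (hG : ∀ k, |∑ e : OffDiag n, resid Z A eOut eIn θs γs k e *
      ((A e.1.1 e.1.2 : ℝ) - edgeProb Z θs γs e.1.1 e.1.2) -
      noisePairing eOut eIn (projCoeff Z A eOut eIn θs γs k)| ≤ G)
    (hH : IsUnit (H Z A eOut eIn θs γs).det)
    (hHn : linftyNorm (H Z A eOut eIn θs γs)⁻¹ ≤ lam / (n : ℝ) ^ 2)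
    (hg : 2 * (lam / (n : ℝ) ^ 2 * G) + 4 * lam * q * D ^ 2 / (m ^ 6 * (n - 1) ^ 2) < g)
    (hr : D / (m ^ 2 * (n - 1)) + p * q * g / (4 * m ^ 2) < r)
    (hbox : 2 * r + p * q * g ≤ 1) (hquad : lam * p ^ 2 * q ^ 3 * g ≤ m ^ 6) :
    (∃ θ γ, IsMomentEstimate Z A eOut eIn θ γ) ∧
      ∀ θ γ, IsMomentEstimate Z A eOut eIn θ γ → ‖θ - θs‖ ≤ r ∧ ‖γ - γs‖ ≤ g := by
  have hN : (0 : ℝ) < n - 1 := by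
    have : (3 : ℝ) ≤ n := by exact_mod_cast hn
    linarith
  have i₀ : Fin n := ⟨0, by omega⟩
  have hD : 0 ≤ D := (abs_nonneg _).trans (hrowD i₀)
  have hg0 : 0 < g := lt_of_le_of_lt (by positivity) hg
  have hr0 : 0 < r := lt_of_le_of_lt (by positivity) hr
  have hm4 : m ≤ 1 / 4 := by
    have e₀ : OffDiag n := ⟨(⟨0, by omega⟩, ⟨1, by omega⟩), by simp⟩
    exact (hmw e₀ _ (by rw [sub_self, abs_zero]; exact zero_le_one)).trans (logisticDeriv_le _)
  have hw : ∀ e, m ≤ weight Z θs γs e := fun e => hmw e _ (by simp)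
  have hkey : ∃ x ∈ Metric.closedBall θs r ×ˢ Metric.closedBall γs g,
      momentMap Z A eOut eIn x = 0 := by
    refine exists_eq_of_a_priori (T := momentMap Z A eOut eIn) (x₀ := (θs, γs))
      (fun x => ⟨_, hasStrictFDerivAt_momentMap Z A eOut eIn x,
        surjective_momentDeriv Z A eOut eIn hn hH x⟩)
      ((isCompact_closedBall _ _).prod (isCompact_closedBall _ _))
      ⟨Metric.mem_closedBall_self hr0.le, Metric.mem_closedBall_self hg0.le⟩ 0 ?_
    rintro ⟨θ, γ⟩ ⟨hθ, hγ⟩ s hs heq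
    rw [mem_closedBall_iff_norm] at hθ hγ
    have heq' : momentMap Z A eOut eIn (θ, γ) = (1 - s) • momentMap Z A eOut eIn (θs, γs) := by
      rw [heq]; module
    have hF : F Z A eOut eIn θ γ = (1 - s) • F Z A eOut eIn θs γs := congrArg Prod.fst heq'
    have hQ : Q Z A θ γ = (1 - s) • Q Z A θs γs := congrArg Prod.snd heq'
    simp only at hθ hγ
    set a := ‖θ - θs‖ with ha
    set b := ‖γ - γs‖ with hb
    have ha0 : 0 ≤ a := norm_nonneg _
    have hb0 : 0 ≤ b := norm_nonneg _
    have hpq : (0 : ℝ) ≤ p * q := by positivity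
    have hb1 : p * q * b ≤ p * q * g := mul_le_mul_of_nonneg_left hγ hpq
    have h1 := norm_theta_sub_le Z A eOut eIn θs γs hn hm hmn hq0 hmw hq hrowD hcolD hs
      (θ := θ) (γ := γ) (by linarith) hF
    have h2 := norm_gamma_sub_le Z A eOut eIn θs γs hn hm hmn hq0 hG0 hw hq hG hH hHn hs
      (θ := θ) (γ := γ) hF hQ
    rw [← ha, ← hb] at h1 h2
    set K := D / (m ^ 2 * (n - 1)) with hK
    have hK0 : 0 ≤ K := by positivity
    have h3 : a ≤ K + p * q * b / (4 * m ^ 2) := by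
      refine h1.trans_eq ?_
      rw [hK]; field_simp
    have har : a < r := by
      have : p * q * b / (4 * m ^ 2) ≤ p * q * g / (4 * m ^ 2) := by gcongr
      linarith
    have hu : 2 * a + p * q * b ≤ 2 * K + p * q * b / m ^ 2 := by
      have h4 : p * q * b ≤ p * q * b / (2 * m ^ 2) := by
        rw [le_div_iff₀ (by positivity)]
        exact mul_le_of_le_one_right (by positivity) (by nlinarith)
      have h5 : p * q * b / m ^ 2 = p * q * b / (2 * m ^ 2) + 2 * (p * q * b / (4 * m ^ 2)) := by
        field_simp; ring
      linarith
    have hu2 : (2 * a + p * q * b) ^ 2 ≤ 8 * K ^ 2 + 2 * (p * q * b / m ^ 2) ^ 2 := by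
      have h0 : 0 ≤ 2 * a + p * q * b := by positivity
      nlinarith [pow_le_pow_left₀ h0 hu 2, sq_nonneg (2 * K - p * q * b / m ^ 2)]
    have hbg : b < g := by
      have h4 : b ≤ lam / (n : ℝ) ^ 2 * (G + (n : ℝ) ^ 2 * (q / m ^ 2 *
          ((8 * K ^ 2 + 2 * (p * q * b / m ^ 2) ^ 2) / 4))) := by
        refine h2.trans ?_
        gcongr
      have h5 : lam / (n : ℝ) ^ 2 * (G + (n : ℝ) ^ 2 * (q / m ^ 2 *
          ((8 * K ^ 2 + 2 * (p * q * b / m ^ 2) ^ 2) / 4))) =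
          lam / (n : ℝ) ^ 2 * G + 2 * lam * q * D ^ 2 / (m ^ 6 * (n - 1) ^ 2) +
            (lam * p ^ 2 * q ^ 3 * b / m ^ 6) * b / 2 := by
        have : (n : ℝ) ≠ 0 := by positivity
        rw [hK]; field_simp; ring
      -- The term quadratic in `b` is at most `b / 2` and is absorbed on the left, which explains
      -- the doubled terms in `hg`.
      have h6 : lam * p ^ 2 * q ^ 3 * b / m ^ 6 ≤ 1 := by
        rw [div_le_one (by positivity)]
        exact (mul_le_mul_of_nonneg_left hγ (by positivity)).trans hquad
      have h7 : (lam * p ^ 2 * q ^ 3 * b / m ^ 6) * b ≤ 1 * b :=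
        mul_le_mul_of_nonneg_right h6 hb0
      have h8 : 4 * lam * q * D ^ 2 / (m ^ 6 * (n - 1) ^ 2) =
          2 * (2 * lam * q * D ^ 2 / (m ^ 6 * (n - 1) ^ 2)) := by ring
      linarith
    rw [interior_prod_eq]
    exact ⟨Metric.ball_subset_interior_closedBall (mem_ball_iff_norm.2 har),
      Metric.ball_subset_interior_closedBall (mem_ball_iff_norm.2 hbg)⟩
  obtain ⟨x, ⟨hx1, hx2⟩, hx⟩ := hkey
  refine ⟨⟨x.1, x.2, (isMomentEstimate_iff Z A eOut eIn x).2 hx⟩, fun θ γ h => ?_⟩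
  have h1 := (isMomentEstimate_iff Z A eOut eIn (θ, γ)).1 h
  -- Global injectivity places every solution, wherever it was, in the box.
  have h2 : (θ, γ) = x := momentMap_injective Z A eOut eIn hn hH (h1.trans hx.symm)
  subst h2
  exact ⟨mem_closedBall_iff_norm.1 hx1, mem_closedBall_iff_norm.1 hx2⟩

end

end PrivateBeta

/-! ### Moments and tails of the discrete Laplace noise. -/

namespace PrivateBeta

section Laplace

lemma kappa_eq (ε : ℝ) : kappa ε = 4 / ε := by
  rw [kappa, laplaceParam, one_div, ← Real.exp_neg, Real.log_exp, neg_neg, inv_div]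
  ring

lemma kappa_pos {ε : ℝ} (hε : 0 < ε) : 0 < kappa ε := by rw [kappa_eq]; positivity

lemma hasSum_pow_natAbs {b : ℝ} (hb0 : 0 ≤ b) (hb1 : b < 1) :
    HasSum (fun k : ℤ => b ^ k.natAbs) ((1 + b) / (1 - b)) := by
  have h1 : HasSum (fun k : ℕ => b ^ (k : ℤ).natAbs) (1 - b)⁻¹ := by
    simpa using hasSum_geometric_of_lt_one hb0 hb1
  have h2 : HasSum (fun k : ℕ => b ^ (-((k : ℤ) + 1)).natAbs) (b * (1 - b)⁻¹) := by
    have h3 : (fun k : ℕ => b ^ (-((k : ℤ) + 1)).natAbs) = fun k => b * b ^ k := by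
      funext k
      rw [show (-((k : ℤ) + 1)).natAbs = k + 1 by omega, pow_succ']
    rw [h3]
    exact (hasSum_geometric_of_lt_one hb0 hb1).mul_left b
  have h3 := HasSum.of_nat_of_neg_add_one (f := fun k : ℤ => b ^ k.natAbs) h1 h2
  have h4 : (1 - b)⁻¹ + b * (1 - b)⁻¹ = (1 + b) / (1 - b) := by ring
  exact h4 ▸ h3

variable {Ω : Type*} [MeasurableSpace Ω] {μ : Measure Ω} {X : Ω → ℤ} {ε : ℝ}

/-- The law is symmetric, so the integral equals its own negative. The default value 0 of the
Bochner integral dispenses with integrability. -/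
lemma integral_laplace (hX : Measurable X)
    (hlaw : ∀ k, μ {ω | X ω = k} = ENNReal.ofReal (discreteLaplace (laplaceParam ε) k)) :
    ∫ ω, (X ω : ℝ) ∂μ = 0 := by
  have hX' : Measurable fun ω => -X ω := hX.neg
  have hmap : μ.map X = μ.map fun ω => -X ω := by
    refine Measure.ext_of_singleton fun k => ?_
    rw [Measure.map_apply hX (measurableSet_singleton k),
      Measure.map_apply hX' (measurableSet_singleton k)]
    have h1 := hlaw k
    have h2 := hlaw (-k)
    have h3 : (fun ω => -X ω) ⁻¹' {k} = {ω | X ω = -k} := by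
      ext ω; simp [neg_eq_iff_eq_neg]
    rw [h3, h2, discreteLaplace, Int.natAbs_neg]
    exact h1
  have hc : Measurable fun k : ℤ => (k : ℝ) := measurable_of_countable _
  have h1 : ∫ ω, (X ω : ℝ) ∂μ = ∫ k : ℤ, (k : ℝ) ∂(μ.map X) :=
    (integral_map hX.aemeasurable hc.aestronglyMeasurable).symm
  have h2 : ∫ k : ℤ, (k : ℝ) ∂(μ.map X) = ∫ ω, ((-X ω : ℤ) : ℝ) ∂μ := by
    rw [hmap]; exact integral_map hX'.aemeasurable hc.aestronglyMeasurable
  have h3 : ∫ ω, ((-X ω : ℤ) : ℝ) ∂μ = -∫ ω, (X ω : ℝ) ∂μ := by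
    rw [← integral_neg]; congr 1; ext ω; push_cast; rfl
  linarith

/-- The exponent `1 / κ = ε / 4` is half the decay rate of the law. With `b = e^{-ε/4}` a two-sided
geometric series gives `(1 + b)² / (1 + b²) ≤ 2`, uniformly in `ε`. -/
lemma lintegral_exp_abs_laplace_le (hX : Measurable X) (hε : 0 < ε)
    (hlaw : ∀ k, μ {ω | X ω = k} = ENNReal.ofReal (discreteLaplace (laplaceParam ε) k)) :
    ∫⁻ ω, ENNReal.ofReal (Real.exp (|(X ω : ℝ)| / kappa ε)) ∂μ ≤ ENNReal.ofReal 2 := by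
  set b := Real.exp (-(ε / 4)) with hb
  have hb0 : 0 < b := Real.exp_pos _
  have hb1 : b < 1 := by rw [hb, Real.exp_lt_one_iff]; linarith
  have hab : laplaceParam ε = b ^ 2 := by
    rw [laplaceParam, hb, ← Real.exp_nat_mul]; congr 1; push_cast; ring
  have hexp : ∀ k : ℤ, Real.exp (|(k : ℝ)| / kappa ε) = (b ^ k.natAbs)⁻¹ := by
    intro k
    rw [hb, ← Real.exp_nat_mul, ← Real.exp_neg, kappa_eq, Nat.cast_natAbs, Int.cast_abs]
    congr 1
    field_simp
  have hterm : ∀ k : ℤ, Real.exp (|(k : ℝ)| / kappa ε) * discreteLaplace (laplaceParam ε) k =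
      (1 - b ^ 2) / (1 + b ^ 2) * b ^ k.natAbs := by
    intro k
    have : b ^ k.natAbs ≠ 0 := by positivity
    rw [hexp, discreteLaplace, hab, ← pow_mul, mul_comm 2, pow_mul, sq (b ^ _)]
    field_simp
  have hb2 : b ^ 2 < 1 := by nlinarith
  have hsum := (hasSum_pow_natAbs hb0.le hb1).mul_left ((1 - b ^ 2) / (1 + b ^ 2))
  have h1 : ∫⁻ ω, ENNReal.ofReal (Real.exp (|(X ω : ℝ)| / kappa ε)) ∂μ =
      ∫⁻ k : ℤ, ENNReal.ofReal (Real.exp (|(k : ℝ)| / kappa ε)) ∂(μ.map X) :=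
    (lintegral_map (f := fun k : ℤ => ENNReal.ofReal (Real.exp (|(k : ℝ)| / kappa ε)))
      (measurable_of_countable _) hX).symm
  rw [h1, lintegral_countable']
  have h2 : ∀ k : ℤ, ENNReal.ofReal (Real.exp (|(k : ℝ)| / kappa ε)) * (μ.map X) {k} =
      ENNReal.ofReal ((1 - b ^ 2) / (1 + b ^ 2) * b ^ k.natAbs) := by
    intro k
    rw [Measure.map_apply hX (measurableSet_singleton k), ← hterm,
      ENNReal.ofReal_mul (Real.exp_pos _).le, ← hlaw]
    rfl
  simp only [h2]
  rw [← ENNReal.ofReal_tsum_of_nonneg _ hsum.summable, hsum.tsum_eq]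
  · refine ENNReal.ofReal_le_ofReal ?_
    have h3 : (1 - b ^ 2) / (1 + b ^ 2) * ((1 + b) / (1 - b)) = (1 + b) ^ 2 / (1 + b ^ 2) := by
      have : 1 - b ≠ 0 := by linarith
      field_simp
      ring
    rw [h3, div_le_iff₀ (by positivity)]
    nlinarith [sq_nonneg (1 - b)]
  · intro k
    have : 0 ≤ 1 - b ^ 2 := by linarith
    positivity

lemma integrable_exp_abs_laplace (hX : Measurable X) (hε : 0 < ε)
    (hlaw : ∀ k, μ {ω | X ω = k} = ENNReal.ofReal (discreteLaplace (laplaceParam ε) k)) :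
    Integrable (fun ω => Real.exp (|(X ω : ℝ)| / kappa ε)) μ ∧
      ∫ ω, Real.exp (|(X ω : ℝ)| / kappa ε) ∂μ ≤ 2 := by
  have hm : Measurable fun ω => Real.exp (|(X ω : ℝ)| / kappa ε) :=
    (measurable_of_countable fun k : ℤ => Real.exp (|(k : ℝ)| / kappa ε)).comp hX
  have h0 := lintegral_exp_abs_laplace_le hX hε hlaw
  have hnn : 0 ≤ᵐ[μ] fun ω => Real.exp (|(X ω : ℝ)| / kappa ε) :=
    Eventually.of_forall fun ω => (Real.exp_pos _).le
  constructor
  · refine ⟨hm.aestronglyMeasurable, ?_⟩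
    rw [hasFiniteIntegral_iff_ofReal hnn]
    exact h0.trans_lt ENNReal.ofReal_lt_top
  · rw [integral_eq_lintegral_of_nonneg_ae hnn hm.aestronglyMeasurable]
    exact ENNReal.toReal_le_of_le_ofReal (by norm_num) h0

/-- Markov's inequality at the level where the exponential equals `n²`, so that a union over the
`2n` noises still costs only `O(1/n)`. -/
lemma measureReal_laplace_tail_le [IsFiniteMeasure μ] (hX : Measurable X) (hε : 0 < ε)
    (hlaw : ∀ k, μ {ω | X ω = k} = ENNReal.ofReal (discreteLaplace (laplaceParam ε) k))
    {n : ℕ} (hn : 0 < n) :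
    μ.real {ω | 2 * kappa ε * Real.log n ≤ |(X ω : ℝ)|} ≤ 2 / (n : ℝ) ^ 2 := by
  obtain ⟨h1, h2⟩ := integrable_exp_abs_laplace hX hε hlaw
  have hn' : (0 : ℝ) < n := by exact_mod_cast hn
  have h3 := mul_meas_ge_le_integral_of_nonneg
    (Eventually.of_forall fun ω => (Real.exp_pos (|(X ω : ℝ)| / kappa ε)).le) h1 ((n : ℝ) ^ 2)
  have hset : {ω | 2 * kappa ε * Real.log n ≤ |(X ω : ℝ)|} =
      {ω | (n : ℝ) ^ 2 ≤ Real.exp (|(X ω : ℝ)| / kappa ε)} := by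
    ext ω
    simp only [Set.mem_ofPred_eq]
    rw [← Real.log_le_iff_le_exp (by positivity), Real.log_pow, le_div_iff₀ (kappa_pos hε)]
    push_cast
    rw [show 2 * Real.log n * kappa ε = 2 * kappa ε * Real.log n by ring]
  rw [hset, le_div_iff₀ (by positivity), mul_comm]
  exact h3.trans h2

lemma memLp_two_laplace (hX : Measurable X) (hε : 0 < ε)
    (hlaw : ∀ k, μ {ω | X ω = k} = ENNReal.ofReal (discreteLaplace (laplaceParam ε) k)) :
    MemLp (fun ω => (X ω : ℝ)) 2 μ ∧ ∫ ω, (X ω : ℝ) ^ 2 ∂μ ≤ 4 * kappa ε ^ 2 := by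
  obtain ⟨h1, h2⟩ := integrable_exp_abs_laplace hX hε hlaw
  have hk := kappa_pos hε
  have hm : Measurable fun ω => (X ω : ℝ) :=
    (measurable_of_countable fun k : ℤ => (k : ℝ)).comp hX
  have hle : ∀ ω, (X ω : ℝ) ^ 2 ≤ 2 * kappa ε ^ 2 * Real.exp (|(X ω : ℝ)| / kappa ε) := by
    intro ω
    have h3 := Real.quadratic_le_exp_of_nonneg (x := |(X ω : ℝ)| / kappa ε) (by positivity)
    have h4 : (|(X ω : ℝ)| / kappa ε) ^ 2 / 2 ≤ Real.exp (|(X ω : ℝ)| / kappa ε) := by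
      have : 0 ≤ |(X ω : ℝ)| / kappa ε := by positivity
      linarith
    calc (X ω : ℝ) ^ 2 = 2 * kappa ε ^ 2 * ((|(X ω : ℝ)| / kappa ε) ^ 2 / 2) := by
          rw [div_pow, sq_abs]; field_simp
      _ ≤ _ := mul_le_mul_of_nonneg_left h4 (by positivity)
  have hint : Integrable (fun ω => (X ω : ℝ) ^ 2) μ :=
    (h1.const_mul (2 * kappa ε ^ 2)).mono' (hm.pow_const 2).aestronglyMeasurable
      (Eventually.of_forall fun ω => by
        rw [Real.norm_eq_abs, abs_of_nonneg (sq_nonneg _)]; exact hle ω)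
  refine ⟨(memLp_two_iff_integrable_sq hm.aestronglyMeasurable).2 hint, ?_⟩
  calc ∫ ω, (X ω : ℝ) ^ 2 ∂μ
      ≤ ∫ ω, 2 * kappa ε ^ 2 * Real.exp (|(X ω : ℝ)| / kappa ε) ∂μ :=
        integral_mono hint (h1.const_mul _) hle
    _ = 2 * kappa ε ^ 2 * ∫ ω, Real.exp (|(X ω : ℝ)| / kappa ε) ∂μ := integral_const_mul _ _
    _ ≤ 2 * kappa ε ^ 2 * 2 := mul_le_mul_of_nonneg_left h2 (by positivity)
    _ = 4 * kappa ε ^ 2 := by ring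

end Laplace

/-! ### Concentration of linear statistics of the graph and the noise. -/

section Model

variable {n p : ℕ} {Ω : Type*} [MeasurableSpace Ω] {μ : Measure Ω}
  {Z : Fin n → Fin n → Fin p → ℝ} {θ : ThetaIdx n → ℝ} {γ : Fin p → ℝ} {ε : ℝ}
  {A : Ω → Fin n → Fin n → ℤ} {eOut eIn : Ω → Fin n → ℤ}

/-- All the random data of the model, as one real-valued family. -/
noncomputable def observation (A : Ω → Fin n → Fin n → ℤ) (eOut eIn : Ω → Fin n → ℤ)
    (x : OffDiag n ⊕ (Fin n ⊕ Fin n)) (ω : Ω) : ℝ :=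
  ((Sum.elim (fun (e : OffDiag n) (ω : Ω) => A ω e.1.1 e.1.2)
    (Sum.elim (fun (i : Fin n) (ω : Ω) => eOut ω i) (fun (i : Fin n) (ω : Ω) => eIn ω i)) x ω : ℤ)
    : ℝ)

lemma iIndepFun_observation (h : IsPrivateModel μ Z θ γ ε A eOut eIn) :
    iIndepFun (observation A eOut eIn) μ :=
  h.indep.comp (fun _ (k : ℤ) => (k : ℝ)) fun _ => measurable_of_countable _

lemma measurable_observation (h : IsPrivateModel μ Z θ γ ε A eOut eIn)
    (x : OffDiag n ⊕ (Fin n ⊕ Fin n)) : Measurable (observation A eOut eIn x) := by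
  have hc : Measurable fun k : ℤ => (k : ℝ) := measurable_of_countable _
  rcases x with e | i | i
  · exact hc.comp (h.measurable_edge _ _)
  · exact hc.comp (h.measurable_out _)
  · exact hc.comp (h.measurable_in _)

lemma edge_mem_Icc (h : IsPrivateModel μ Z θ γ ε A eOut eIn) (e : OffDiag n) (ω : Ω) :
    observation A eOut eIn (Sum.inl e) ω ∈ Set.Icc (0 : ℝ) 1 := by
  rcases h.binary ω e.1.1 e.1.2 with h1 | h1 <;> simp [observation, h1]

lemma integral_edge (h : IsPrivateModel μ Z θ γ ε A eOut eIn) (e : OffDiag n) :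
    ∫ ω, observation A eOut eIn (Sum.inl e) ω ∂μ = edgeProb Z θ γ e.1.1 e.1.2 := by
  have hset : MeasurableSet {ω | A ω e.1.1 e.1.2 = 1} :=
    h.measurable_edge e.1.1 e.1.2 (measurableSet_singleton 1)
  have h1 : observation A eOut eIn (Sum.inl e) =
      {ω | A ω e.1.1 e.1.2 = 1}.indicator fun _ => (1 : ℝ) := by
    ext ω
    rcases h.binary ω e.1.1 e.1.2 with h1 | h1 <;> simp [observation, h1]
  rw [h1, integral_indicator_const _ hset, measureReal_def, h.edge_law _ _ e.2,
    ENNReal.toReal_ofReal (show 0 ≤ edgeProb Z θ γ e.1.1 e.1.2 from (logistic_pos _).le)]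
  simp

/-- The means of the observations. -/
noncomputable def obsMean (Z : Fin n → Fin n → Fin p → ℝ) (θ : ThetaIdx n → ℝ) (γ : Fin p → ℝ) :
    OffDiag n ⊕ (Fin n ⊕ Fin n) → ℝ :=
  Sum.elim (fun e => edgeProb Z θ γ e.1.1 e.1.2) fun _ => 0

lemma integral_observation (h : IsPrivateModel μ Z θ γ ε A eOut eIn)
    (x : OffDiag n ⊕ (Fin n ⊕ Fin n)) :
    ∫ ω, observation A eOut eIn x ω ∂μ = obsMean Z θ γ x := by
  rcases x with e | i | i
  · exact integral_edge h e
  · exact integral_laplace (h.measurable_out i) (h.out_law i)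
  · exact integral_laplace (h.measurable_in i) (h.in_law i)

variable [IsProbabilityMeasure μ]

lemma memLp_observation (hε : 0 < ε) (h : IsPrivateModel μ Z θ γ ε A eOut eIn)
    (x : OffDiag n ⊕ (Fin n ⊕ Fin n)) : MemLp (observation A eOut eIn x) 2 μ := by
  rcases x with e | i | i
  · exact memLp_of_bounded (Eventually.of_forall (edge_mem_Icc h e))
      (measurable_observation h _).aestronglyMeasurable 2
  · exact (memLp_two_laplace (h.measurable_out i) hε (h.out_law i)).1
  · exact (memLp_two_laplace (h.measurable_in i) hε (h.in_law i)).1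

/-- Upper bounds for the variances of the observations. -/
noncomputable def obsVar (n : ℕ) (ε : ℝ) : OffDiag n ⊕ (Fin n ⊕ Fin n) → ℝ :=
  Sum.elim (fun _ => 1 / 4) fun _ => 4 * kappa ε ^ 2

lemma variance_observation_le (hε : 0 < ε) (h : IsPrivateModel μ Z θ γ ε A eOut eIn)
    (x : OffDiag n ⊕ (Fin n ⊕ Fin n)) :
    variance (observation A eOut eIn x) μ ≤ obsVar n ε x := by
  have hm := (measurable_observation h x).aestronglyMeasurable (μ := μ)
  rcases x with e | i | i
  · refine (variance_le_sq_of_bounded (Eventually.of_forall (edge_mem_Icc h e))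
      hm.aemeasurable).trans ?_
    simp only [obsVar, Sum.elim_inl]; norm_num
  · exact (variance_le_expectation_sq hm).trans
      (memLp_two_laplace (h.measurable_out i) hε (h.out_law i)).2
  · exact (variance_le_expectation_sq hm).trans
      (memLp_two_laplace (h.measurable_in i) hε (h.in_law i)).2

/-- Chebyshev's inequality for linear combinations of the observations. -/
lemma measureReal_linear_ge_le (hε : 0 < ε) (h : IsPrivateModel μ Z θ γ ε A eOut eIn)
    (c : OffDiag n ⊕ (Fin n ⊕ Fin n) → ℝ) {t : ℝ} (ht : 0 < t) :
    μ.real {ω | t ≤ |∑ x, c x * (observation A eOut eIn x ω - obsMean Z θ γ x)|} ≤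
      (∑ x, c x ^ 2 * obsVar n ε x) / t ^ 2 := by
  set Y : OffDiag n ⊕ (Fin n ⊕ Fin n) → Ω → ℝ := fun x ω => c x * observation A eOut eIn x ω
  have hY : ∀ x, MemLp (Y x) 2 μ := fun x => (memLp_observation hε h x).const_mul (c x)
  have hind : iIndepFun Y μ :=
    (iIndepFun_observation h).comp (fun x y => c x * y) fun x => measurable_const_mul (c x)
  have hvar : variance (∑ x, Y x) μ ≤ ∑ x, c x ^ 2 * obsVar n ε x := by
    rw [IndepFun.variance_sum (fun x _ => hY x) fun x _ y _ hxy => hind.indepFun hxy]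
    refine Finset.sum_le_sum fun x _ => ?_
    rw [variance_const_mul]
    exact mul_le_mul_of_nonneg_left (variance_observation_le hε h x) (sq_nonneg _)
  have hS : MemLp (∑ x, Y x) 2 μ := memLp_finsetSum' _ fun x _ => hY x
  have hcheb := meas_ge_le_variance_div_sq hS ht
  have hmean : ∫ ω, (∑ x, Y x) ω ∂μ = ∑ x, c x * obsMean Z θ γ x := by
    simp only [Finset.sum_apply]
    rw [integral_finsetSum _ fun x _ => (hY x).integrable (by norm_num)]
    refine Finset.sum_congr rfl fun x _ => ?_
    rw [integral_const_mul, integral_observation h]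
  have hset : {ω | t ≤ |∑ x, c x * (observation A eOut eIn x ω - obsMean Z θ γ x)|} =
      {ω | t ≤ |(∑ x, Y x) ω - ∫ ω, (∑ x, Y x) ω ∂μ|} := by
    ext ω
    simp only [Set.mem_ofPred_eq]
    rw [hmean, Finset.sum_apply, ← Finset.sum_sub_distrib]
    simp only [mul_sub, Y]
  rw [hset, measureReal_def]
  refine ENNReal.toReal_le_of_le_ofReal ?_ (hcheb.trans (ENNReal.ofReal_le_ofReal ?_))
  · refine div_nonneg (Finset.sum_nonneg fun x _ => mul_nonneg (sq_nonneg _) ?_) (sq_nonneg _)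
    exact (variance_nonneg _ _).trans (variance_observation_le hε h x)
  · gcongr

/-- Hoeffding's inequality for sums of centred edge indicators. -/
lemma measureReal_edge_sum_ge_le (h : IsPrivateModel μ Z θ γ ε A eOut eIn)
    (s : Finset (OffDiag n)) (hs : (s.card : ℝ) ≤ n) (hn : 1 < n) :
    μ.real {ω | Real.sqrt (n * Real.log n) ≤
      |∑ e ∈ s, ((A ω e.1.1 e.1.2 : ℝ) - edgeProb Z θ γ e.1.1 e.1.2)|} ≤ 2 / (n : ℝ) ^ 2 := by
  set t := Real.sqrt (n * Real.log n) with ht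
  have hn0 : (1 : ℝ) < n := by exact_mod_cast hn
  have hlog : 0 < Real.log n := Real.log_pos hn0
  have ht2 : t ^ 2 = n * Real.log n := Real.sq_sqrt (by positivity)
  have ht0 : 0 ≤ t := Real.sqrt_nonneg _
  set X : OffDiag n → Ω → ℝ := fun e ω =>
    observation A eOut eIn (Sum.inl e) ω - ∫ ω, observation A eOut eIn (Sum.inl e) ω ∂μ with hX
  have hind : iIndepFun X μ :=
    ((iIndepFun_observation h).precomp Sum.inl_injective).comp
      (fun e y => y - ∫ ω, observation A eOut eIn (Sum.inl e) ω ∂μ)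
      fun e => measurable_id.sub_const _
  have hsub : ∀ e, HasSubgaussianMGF (X e) ((‖(1 : ℝ) - 0‖₊ / 2) ^ 2) μ := fun e =>
    hasSubgaussianMGF_of_mem_Icc (measurable_observation h _).aemeasurable
      (Eventually.of_forall (edge_mem_Icc h e))
  have hind' : iIndepFun (fun e => -X e) μ := hind.comp (fun _ y => -y) fun _ => measurable_neg
  have hcst : ((∑ e ∈ s, (‖(1 : ℝ) - 0‖₊ / 2) ^ 2 : NNReal) : ℝ) = s.card / 4 := by
    rw [Finset.sum_const, nsmul_eq_mul]
    push_cast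
    norm_num
    ring
  -- The exponent is `-2 t² / card ≤ -2 log n`. For empty `s` division by zero would give `exp 0 =
  -- 1`; the event is then empty because `t > 0`.
  have hexp : Real.exp (-t ^ 2 / (2 * (∑ e ∈ s, (‖(1 : ℝ) - 0‖₊ / 2) ^ 2 : NNReal))) ≤
      1 / (n : ℝ) ^ 2 ∨ s.card = 0 := by
    rcases Nat.eq_zero_or_pos s.card with h0 | h0
    · exact Or.inr h0
    left
    have h0' : (0 : ℝ) < s.card := by exact_mod_cast h0
    rw [hcst, ht2, one_div, ← Real.exp_log (show (0 : ℝ) < ((n : ℝ) ^ 2)⁻¹ by positivity),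
      Real.log_inv, Real.log_pow]
    refine Real.exp_le_exp.2 ?_
    rw [neg_div, neg_le_neg_iff, le_div_iff₀ (by positivity)]
    push_cast
    nlinarith
  rcases hexp with hexp | h0
  · have h1 := (HasSubgaussianMGF.measure_sum_ge_le_of_iIndepFun hind
      (fun e (_ : e ∈ s) => hsub e) ht0).trans hexp
    have h2 := (HasSubgaussianMGF.measure_sum_ge_le_of_iIndepFun hind'
      (fun e (_ : e ∈ s) => (hsub e).neg) ht0).trans hexp
    have hsubset : {ω | t ≤ |∑ e ∈ s, ((A ω e.1.1 e.1.2 : ℝ) - edgeProb Z θ γ e.1.1 e.1.2)|} ⊆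
        {ω | t ≤ ∑ e ∈ s, X e ω} ∪ {ω | t ≤ ∑ e ∈ s, (-X e) ω} := by
      intro ω hω
      simp only [Set.mem_ofPred_eq, Set.mem_union, Pi.neg_apply, Finset.sum_neg_distrib] at hω ⊢
      have h3 : ∑ e ∈ s, X e ω =
          ∑ e ∈ s, ((A ω e.1.1 e.1.2 : ℝ) - edgeProb Z θ γ e.1.1 e.1.2) :=
        Finset.sum_congr rfl fun e _ => by rw [hX]; simp only [integral_edge h]; rfl
      rw [h3]
      exact le_abs.1 hω
    calc _ ≤ _ := measureReal_mono hsubset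
      _ ≤ _ := measureReal_union_le _ _
      _ ≤ 1 / (n : ℝ) ^ 2 + 1 / (n : ℝ) ^ 2 := add_le_add h1 h2
      _ = 2 / (n : ℝ) ^ 2 := by ring
  · have : {ω | t ≤ |∑ e ∈ s, ((A ω e.1.1 e.1.2 : ℝ) - edgeProb Z θ γ e.1.1 e.1.2)|} = ∅ := by
      rw [Finset.card_eq_zero.1 h0]
      ext ω
      simp only [Finset.sum_empty, abs_zero, Set.mem_ofPred_eq, Set.mem_empty_iff_false, iff_false,
        not_le, ht]
      positivity
    rw [this, measureReal_empty]
    positivity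

end Model

end PrivateBeta

/-! ### Simultaneous control of all residuals at the true parameters. -/

namespace PrivateBeta

variable {n p : ℕ}

lemma sum_filter_fst_eq (y : Fin n → Fin n → ℝ) (i : Fin n) :
    ∑ e ∈ Finset.univ.filter (fun e : OffDiag n => e.1.1 = i), y e.1.1 e.1.2 =
      ∑ j ∈ Finset.univ.filter (fun j => j ≠ i), y i j := by
  rw [Finset.sum_filter, sum_offDiag_row fun i' j => if i' = i then y i' j else 0,
    Finset.sum_eq_single i]
  · simp
  · intro b _ hb; simp [hb]
  · simp

lemma sum_filter_snd_eq (y : Fin n → Fin n → ℝ) (j : Fin n) :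
    ∑ e ∈ Finset.univ.filter (fun e : OffDiag n => e.1.2 = j), y e.1.1 e.1.2 =
      ∑ i ∈ Finset.univ.filter (fun i => i ≠ j), y i j := by
  rw [Finset.sum_filter, sum_offDiag_col fun i j' => if j' = j then y i j' else 0,
    Finset.sum_eq_single j]
  · simp
  · intro b _ hb; simp [hb]
  · simp

lemma card_filter_fst_le (i : Fin n) :
    ((Finset.univ.filter fun e : OffDiag n => e.1.1 = i).card : ℝ) ≤ n := by
  have h := sum_filter_fst_eq (fun _ _ => 1) i
  rw [Finset.sum_const, nsmul_one] at h
  have h1 := sum_filter_ne_le (f := fun _ => 1) (c := 1) i fun _ _ => le_rfl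
  linarith

lemma card_filter_snd_le (j : Fin n) :
    ((Finset.univ.filter fun e : OffDiag n => e.1.2 = j).card : ℝ) ≤ n := by
  have h := sum_filter_snd_eq (fun _ _ => 1) j
  rw [Finset.sum_const, nsmul_one] at h
  have h1 := sum_filter_ne_le (f := fun _ => 1) (c := 1) j fun _ _ => le_rfl
  linarith

variable {Ω : Type*} [MeasurableSpace Ω] {μ : Measure Ω}
  {Z : Fin n → Fin n → Fin p → ℝ} {θ : ThetaIdx n → ℝ} {γ : Fin p → ℝ} {ε : ℝ}
  {A : Ω → Fin n → Fin n → ℤ} {eOut eIn : Ω → Fin n → ℤ}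

lemma measureReal_iUnion_fin_le {m : ℕ} {s : Fin m → Set Ω} {c : ℝ} (h : ∀ i, μ.real (s i) ≤ c) :
    μ.real (⋃ i, s i) ≤ m * c := by
  refine (measureReal_iUnion_fintype_le s).trans ?_
  refine (Finset.sum_le_card_nsmul _ _ c fun i _ => h i).trans ?_
  simp

variable [IsProbabilityMeasure μ]

/-- The total noise discrepancy between the released out- and in-degrees. -/
lemma measureReal_noise_total_ge_le (hε : 0 < ε) (h : IsPrivateModel μ Z θ γ ε A eOut eIn)
    (hn : 1 < n) :
    μ.real {ω | Real.sqrt (n * Real.log n) * kappa ε ≤ |∑ i, (eOut ω i : ℝ) -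
      ∑ j : Fin n, if (j : ℕ) < n - 1 then (eIn ω j : ℝ) else 0|} ≤ 8 / Real.log n := by
  have hn0 : (1 : ℝ) < n := by exact_mod_cast hn
  have hlog : 0 < Real.log n := Real.log_pos hn0
  have hk := kappa_pos hε
  have h1 := measureReal_linear_ge_le hε h
    (Sum.elim (fun _ => 0) (Sum.elim (fun _ => 1) fun j => if (j : ℕ) < n - 1 then -1 else 0))
    (t := Real.sqrt (n * Real.log n) * kappa ε) (by positivity)
  have h2 : ∀ ω, ∑ x, (Sum.elim (fun _ => 0) (Sum.elim (fun _ => 1)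
      fun j => if (j : ℕ) < n - 1 then -1 else 0) : OffDiag n ⊕ (Fin n ⊕ Fin n) → ℝ) x *
        (observation A eOut eIn x ω - obsMean Z θ γ x) =
      ∑ i, (eOut ω i : ℝ) - ∑ j : Fin n, if (j : ℕ) < n - 1 then (eIn ω j : ℝ) else 0 := by
    intro ω
    simp [Fintype.sum_sum_type, observation, obsMean, sub_eq_add_neg, ← Finset.sum_neg_distrib,
      ite_mul, neg_ite]
  simp only [h2] at h1
  refine h1.trans ?_
  -- The variance is at most `8 n κ²` and the squared threshold is `n log n κ²`.
  rw [mul_pow, Real.sq_sqrt (by positivity), div_le_div_iff₀ (by positivity) hlog]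
  have h3 : ∑ x, (Sum.elim (fun _ => 0) (Sum.elim (fun _ => 1)
      fun j => if (j : ℕ) < n - 1 then -1 else 0) : OffDiag n ⊕ (Fin n ⊕ Fin n) → ℝ) x ^ 2 *
        obsVar n ε x ≤ n * (4 * kappa ε ^ 2) + n * (4 * kappa ε ^ 2) := by
    simp only [Fintype.sum_sum_type, obsVar, Sum.elim_inl, Sum.elim_inr]
    have h4 : ∑ j : Fin n, (if (j : ℕ) < n - 1 then (-1 : ℝ) else 0) ^ 2 * (4 * kappa ε ^ 2) ≤
        n * (4 * kappa ε ^ 2) := by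
      refine (Finset.sum_le_card_nsmul _ _ (4 * kappa ε ^ 2) fun j _ => ?_).trans (by simp)
      split_ifs <;> nlinarith [sq_nonneg (kappa ε)]
    have h5 : ∑ i : Fin n, (1 : ℝ) ^ 2 * (4 * kappa ε ^ 2) = n * (4 * kappa ε ^ 2) := by simp
    rw [h5]
    simpa using h4
  nlinarith

/-- The residual of the profiled covariate equation at the true parameters. -/
lemma measureReal_profile_ge_le (hε : 0 < ε) (h : IsPrivateModel μ Z θ γ ε A eOut eIn)
    (hn : 1 < n) {c : ℝ} (hc : 0 < c) {r : OffDiag n → ℝ} (hr : ∀ e, |r e| ≤ c)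
    {w : ThetaIdx n → ℝ} (hw : ‖w‖ ≤ c) :
    μ.real {ω | n * c * (1 + kappa ε) * Real.log n ≤
      |∑ e : OffDiag n, r e * ((A ω e.1.1 e.1.2 : ℝ) - edgeProb Z θ γ e.1.1 e.1.2) -
        noisePairing (eOut ω) (eIn ω) w|} ≤ 9 / Real.log n ^ 2 := by
  have hn0 : (1 : ℝ) < n := by exact_mod_cast hn
  have hlog : 0 < Real.log n := Real.log_pos hn0
  have hk := kappa_pos hε
  have h1 := measureReal_linear_ge_le hε h
    (Sum.elim r (Sum.elim (fun i => -alpha w i) fun j => -beta w j))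
    (t := n * c * (1 + kappa ε) * Real.log n) (by positivity)
  have h2 : ∀ ω, ∑ x, (Sum.elim r (Sum.elim (fun i => -alpha w i)
      fun j => -beta w j) : OffDiag n ⊕ (Fin n ⊕ Fin n) → ℝ) x *
        (observation A eOut eIn x ω - obsMean Z θ γ x) =
      ∑ e : OffDiag n, r e * ((A ω e.1.1 e.1.2 : ℝ) - edgeProb Z θ γ e.1.1 e.1.2) -
        noisePairing (eOut ω) (eIn ω) w := by
    intro ω
    simp only [Fintype.sum_sum_type, observation, obsMean, noisePairing, Sum.elim_inl,
      Sum.elim_inr, sub_zero, neg_mul, Finset.sum_neg_distrib]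
    ring
  simp only [h2] at h1
  refine h1.trans ?_
  have hsq : ∀ x : ℝ, |x| ≤ c → x ^ 2 ≤ c ^ 2 := fun x hx =>
    sq_le_sq' (neg_le_of_abs_le hx) (le_of_abs_le hx)
  have h3 : ∑ x, (Sum.elim r (Sum.elim (fun i => -alpha w i)
      fun j => -beta w j) : OffDiag n ⊕ (Fin n ⊕ Fin n) → ℝ) x ^ 2 * obsVar n ε x ≤
      n ^ 2 * (c ^ 2 * (1 / 4)) + (n * (c ^ 2 * (4 * kappa ε ^ 2)) +
        n * (c ^ 2 * (4 * kappa ε ^ 2))) := by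
    simp only [Fintype.sum_sum_type, obsVar, Sum.elim_inl, Sum.elim_inr, neg_sq]
    refine add_le_add (sum_offDiag_le (by positivity) fun e => ?_) (add_le_add ?_ ?_)
    · exact mul_le_mul_of_nonneg_right (hsq _ (hr e)) (by norm_num)
    · refine (Finset.sum_le_card_nsmul _ _ (c ^ 2 * (4 * kappa ε ^ 2)) fun j _ => ?_).trans
        (by simp)
      exact mul_le_mul_of_nonneg_right (hsq _ ((abs_alpha_le w j).trans hw)) (by positivity)
    · refine (Finset.sum_le_card_nsmul _ _ (c ^ 2 * (4 * kappa ε ^ 2)) fun j _ => ?_).trans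
        (by simp)
      exact mul_le_mul_of_nonneg_right (hsq _ ((abs_beta_le w j).trans hw)) (by positivity)
  have h4 : (n : ℝ) ^ 2 * (c ^ 2 * (1 / 4)) + (n * (c ^ 2 * (4 * kappa ε ^ 2)) +
        n * (c ^ 2 * (4 * kappa ε ^ 2))) ≤ 9 * (n ^ 2 * c ^ 2 * (1 + kappa ε) ^ 2) := by
    have e1 : (n : ℝ) * (c ^ 2 * (4 * kappa ε ^ 2)) ≤ n ^ 2 * (c ^ 2 * (4 * kappa ε ^ 2)) :=
      mul_le_mul_of_nonneg_right (by nlinarith) (by positivity)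
    have e2 : (0 : ℝ) ≤ n ^ 2 * c ^ 2 := by positivity
    have e3 : 1 / 4 + 8 * kappa ε ^ 2 ≤ 9 * (1 + kappa ε) ^ 2 := by nlinarith
    have e4 := mul_le_mul_of_nonneg_left e3 e2
    linarith
  rw [div_le_div_iff₀ (by positivity) (by positivity)]
  calc _ ≤ 9 * (n ^ 2 * c ^ 2 * (1 + kappa ε) ^ 2) * Real.log n ^ 2 :=
        mul_le_mul_of_nonneg_right (h3.trans h4) (by positivity)
    _ = 9 * (n * c * (1 + kappa ε) * Real.log n) ^ 2 := by ring

/-- All the random residuals entering the moment equations are small at the true parameters, up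
to an event of small probability. -/
lemma exists_event_residuals_le (hε : 0 < ε) (h : IsPrivateModel μ Z θ γ ε A eOut eIn)
    (hn : 1 < n) {c : ℝ} (hc : 0 < c) {r : Fin p → OffDiag n → ℝ} (hr : ∀ k e, |r k e| ≤ c)
    {w : Fin p → ThetaIdx n → ℝ} (hw : ∀ k, ‖w k‖ ≤ c) :
    ∃ B : Set Ω, μ.real B ≤ 8 / n + 8 / Real.log n + p * (9 / Real.log n ^ 2) ∧ ∀ ω ∉ B,
      (∀ i, |∑ j ∈ Finset.univ.filter (fun j => j ≠ i),
        ((A ω i j : ℝ) - edgeProb Z θ γ i j) + eOut ω i| ≤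
          2 * Real.sqrt (n * Real.log n) * (1 + kappa ε)) ∧
      (∀ j, |∑ i ∈ Finset.univ.filter (fun i => i ≠ j),
        ((A ω i j : ℝ) - edgeProb Z θ γ i j) + inNoise (eOut ω) (eIn ω) j| ≤
          2 * Real.sqrt (n * Real.log n) * (1 + kappa ε)) ∧
      ∀ k, |∑ e : OffDiag n, r k e * ((A ω e.1.1 e.1.2 : ℝ) - edgeProb Z θ γ e.1.1 e.1.2) -
        noisePairing (eOut ω) (eIn ω) (w k)| ≤ n * c * (1 + kappa ε) * Real.log n := by
  have hn0 : (1 : ℝ) < n := by exact_mod_cast hn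
  have hlog : 0 < Real.log n := Real.log_pos hn0
  have hk := kappa_pos hε
  set T := Real.sqrt (n * Real.log n) with hT
  have hT0 : 0 ≤ T := Real.sqrt_nonneg _
  -- Individual noises, of size `κ log n`, are thereby dominated by the degree fluctuation `T` times
  -- `κ`.
  have hlogT : Real.log n ≤ T := by
    refine Real.le_sqrt_of_sq_le ?_
    have : Real.log n ≤ n := (Real.log_le_sub_one_of_pos (by linarith)).trans (by linarith)
    nlinarith
  set B₁ := ⋃ i, {ω | T ≤ |∑ e ∈ Finset.univ.filter (fun e : OffDiag n => e.1.1 = i),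
    ((A ω e.1.1 e.1.2 : ℝ) - edgeProb Z θ γ e.1.1 e.1.2)|} with hB₁
  set B₂ := ⋃ j, {ω | T ≤ |∑ e ∈ Finset.univ.filter (fun e : OffDiag n => e.1.2 = j),
    ((A ω e.1.1 e.1.2 : ℝ) - edgeProb Z θ γ e.1.1 e.1.2)|} with hB₂
  set B₃ := ⋃ i, {ω | 2 * kappa ε * Real.log n ≤ |(eOut ω i : ℝ)|} with hB₃
  set B₄ := ⋃ i, {ω | 2 * kappa ε * Real.log n ≤ |(eIn ω i : ℝ)|} with hB₄
  set B₅ := {ω | T * kappa ε ≤ |∑ i, (eOut ω i : ℝ) -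
      ∑ j : Fin n, if (j : ℕ) < n - 1 then (eIn ω j : ℝ) else 0|} with hB₅
  set B₆ := ⋃ k, {ω | n * c * (1 + kappa ε) * Real.log n ≤
      |∑ e : OffDiag n, r k e * ((A ω e.1.1 e.1.2 : ℝ) - edgeProb Z θ γ e.1.1 e.1.2) -
        noisePairing (eOut ω) (eIn ω) (w k)|} with hB₆
  have hnn : (n : ℝ) * (2 / (n : ℝ) ^ 2) = 2 / n := by field_simp
  have b₁ : μ.real B₁ ≤ 2 / n := hnn ▸ measureReal_iUnion_fin_le fun i =>
    measureReal_edge_sum_ge_le h _ (card_filter_fst_le i) hn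
  have b₂ : μ.real B₂ ≤ 2 / n := hnn ▸ measureReal_iUnion_fin_le fun j =>
    measureReal_edge_sum_ge_le h _ (card_filter_snd_le j) hn
  have b₃ : μ.real B₃ ≤ 2 / n := hnn ▸ measureReal_iUnion_fin_le fun i =>
    measureReal_laplace_tail_le (h.measurable_out i) hε (h.out_law i) (by omega)
  have b₄ : μ.real B₄ ≤ 2 / n := hnn ▸ measureReal_iUnion_fin_le fun i =>
    measureReal_laplace_tail_le (h.measurable_in i) hε (h.in_law i) (by omega)
  have b₅ : μ.real B₅ ≤ 8 / Real.log n := measureReal_noise_total_ge_le hε h hn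
  have b₆ : μ.real B₆ ≤ p * (9 / Real.log n ^ 2) := measureReal_iUnion_fin_le fun k =>
    measureReal_profile_ge_le hε h hn hc (hr k) (hw k)
  refine ⟨B₁ ∪ B₂ ∪ B₃ ∪ B₄ ∪ B₅ ∪ B₆, ?_, ?_⟩
  · have u₁ := measureReal_union_le (μ := μ) (B₁ ∪ B₂ ∪ B₃ ∪ B₄ ∪ B₅) B₆
    have u₂ := measureReal_union_le (μ := μ) (B₁ ∪ B₂ ∪ B₃ ∪ B₄) B₅
    have u₃ := measureReal_union_le (μ := μ) (B₁ ∪ B₂ ∪ B₃) B₄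
    have u₄ := measureReal_union_le (μ := μ) (B₁ ∪ B₂) B₃
    have u₅ := measureReal_union_le (μ := μ) B₁ B₂
    have : (8 : ℝ) / n = 2 / n + 2 / n + 2 / n + 2 / n := by ring
    linarith
  · intro ω hω
    simp only [Set.mem_union, not_or] at hω
    obtain ⟨⟨⟨⟨⟨o₁, o₂⟩, o₃⟩, o₄⟩, o₅⟩, o₆⟩ := hω
    simp only [hB₁, hB₂, hB₃, hB₄, hB₅, hB₆, Set.mem_iUnion, not_exists, Set.mem_ofPred_eq, not_le]
      at o₁ o₂ o₃ o₄ o₅ o₆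
    have hsum : T + 2 * kappa ε * Real.log n ≤ 2 * T * (1 + kappa ε) := by nlinarith
    refine ⟨fun i => ?_, fun j => ?_, fun k => (o₆ k).le⟩
    · have h1 := o₁ i
      rw [sum_filter_fst_eq (fun i j => (A ω i j : ℝ) - edgeProb Z θ γ i j)] at h1
      exact (abs_add_le _ _).trans ((add_le_add h1.le (o₃ i).le).trans hsum)
    · have h1 := o₂ j
      rw [sum_filter_snd_eq (fun i j => (A ω i j : ℝ) - edgeProb Z θ γ i j)] at h1
      refine (abs_add_le _ _).trans ?_
      unfold inNoise
      split_ifs with hj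
      · exact (add_le_add h1.le (o₄ j).le).trans hsum
      · refine (add_le_add h1.le o₅.le).trans ?_
        nlinarith

end PrivateBeta

/-! ### Rates for a fixed sample size. -/

namespace PrivateBeta

/-- The numerical conditions of `exists_and_forall_momentEstimate` follow from the rate condition. -/
lemma rate_conditions {n L E k lam q P B : ℝ} (hn : 2 ≤ n) (hL : 1 ≤ L) (hE : 1 ≤ E)
    (hk : 1 ≤ k) (hq0 : 0 < q) (hqB : q ≤ B) (hP : 1 ≤ P) (hlam : 4 ≤ lam * (P * q ^ 2))
    (hrate : P ^ 2 * B ^ 3 * (lam ^ 2 * q * E ^ 18 * k ^ 2 * (L / n)) ≤ (1 / 10 ^ 10) ^ 2) :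
    1 ≤ 1 / (12 * E) * (n - 1) ∧
    2 * (lam / n ^ 2 * (n * (q / (1 / (12 * E)) ^ 2) * k * L)) +
      4 * lam * q * (2 * Real.sqrt (n * L) * k) ^ 2 / ((1 / (12 * E)) ^ 6 * (n - 1) ^ 2) <
        2 * 10 ^ 8 * (lam * q * E ^ 9 * L / n * k ^ 2) ∧
    2 * Real.sqrt (n * L) * k / ((1 / (12 * E)) ^ 2 * (n - 1)) +
      P * q * (2 * 10 ^ 8 * (lam * q * E ^ 9 * L / n * k ^ 2)) / (4 * (1 / (12 * E)) ^ 2) <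
        578 * (Real.sqrt (L / n) * k * E ^ 3) ∧
    2 * (578 * (Real.sqrt (L / n) * k * E ^ 3)) +
      P * q * (2 * 10 ^ 8 * (lam * q * E ^ 9 * L / n * k ^ 2)) ≤ 1 ∧
    lam * P ^ 2 * q ^ 3 * (2 * 10 ^ 8 * (lam * q * E ^ 9 * L / n * k ^ 2)) ≤
      (1 / (12 * E)) ^ 6 := by
  have hn0 : 0 < n := by linarith
  have hE0 : 0 < E := by linarith
  have hk0 : 0 < k := by linarith
  have hL0 : 0 < L := by linarith
  have hP0 : 0 < P := by linarith
  have hB0 : 0 < B := hq0.trans_le hqB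
  have hlam0 : 0 < lam := by
    by_contra h
    have : lam * (P * q ^ 2) ≤ 0 :=
      mul_nonpos_of_nonpos_of_nonneg (not_lt.1 h) (by positivity)
    linarith
  set X := L / n with hX
  have hX0 : 0 < X := by positivity
  set S := Real.sqrt X with hS
  have hS0 : 0 < S := Real.sqrt_pos.2 hX0
  have hS2 : S ^ 2 = X := Real.sq_sqrt hX0.le
  have hsqrt : Real.sqrt (n * L) = n * S := by
    rw [hS, ← Real.sqrt_sq hn0.le, ← Real.sqrt_mul (by positivity), Real.sqrt_sq hn0.le, hX]
    congr 1; field_simp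
  have hLX : L = n * X := by rw [hX]; field_simp
  have hW : P ^ 2 * q ^ 3 * (lam ^ 2 * q * E ^ 18 * k ^ 2 * X) ≤ (1 / 10 ^ 10) ^ 2 := by
    refine le_trans ?_ hrate
    gcongr
  -- the two small quantities
  have ht : P * (lam * q ^ 2 * E ^ 8 * k * S) ≤ 1 / 10 ^ 10 := by
    refine le_of_sq_le_sq ?_ (by norm_num)
    refine le_trans ?_ hW
    have e1 : (P * (lam * q ^ 2 * E ^ 8 * k * S)) ^ 2 =
        P ^ 2 * q ^ 3 * (lam ^ 2 * q * E ^ 16 * k ^ 2 * X) := by rw [← hS2]; ring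
    rw [e1]
    gcongr
    norm_num
  -- The lower bound on `lam * (P * q ^ 2)` removes `lam` and `q` from the rate condition.
  have hbig : E ^ 18 * k ^ 2 * X ≤ (1 / 10 ^ 10) ^ 2 := by
    have e1 : 1 ≤ (lam * (P * q ^ 2)) ^ 2 := by nlinarith
    calc E ^ 18 * k ^ 2 * X = 1 * (E ^ 18 * k ^ 2 * X) := by ring
      _ ≤ (lam * (P * q ^ 2)) ^ 2 * (E ^ 18 * k ^ 2 * X) :=
          mul_le_mul_of_nonneg_right e1 (by positivity)
      _ = P ^ 2 * q ^ 3 * (lam ^ 2 * q * E ^ 18 * k ^ 2 * X) := by ring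
      _ ≤ _ := hW
  have hx : S * k * E ^ 3 ≤ 1 / 10 ^ 10 := by
    refine le_of_sq_le_sq ?_ (by norm_num)
    refine le_trans ?_ hbig
    have e1 : (S * k * E ^ 3) ^ 2 = E ^ 6 * k ^ 2 * X := by rw [← hS2]; ring
    rw [e1]
    gcongr
    norm_num
  have hE23 : E ^ 2 ≤ E ^ 3 := pow_le_pow_right₀ hE (by norm_num)
  have hn1 : n / 2 ≤ n - 1 := by linarith
  have hn1' : 0 < n - 1 := by linarith
  have hg : lam * q * E ^ 9 * L / n * k ^ 2 = lam * q * E ^ 9 * X * k ^ 2 := by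
    rw [hX]; ring
  have hpqg : P * q * (lam * q * E ^ 9 * X * k ^ 2) =
      P * (lam * q ^ 2 * E ^ 8 * k * S) * (S * k * E) := by rw [← hS2]; ring
  rw [hg, hsqrt]
  refine ⟨?_, ?_, ?_, ?_, ?_⟩
  · rw [one_div_mul_eq_div, le_div_iff₀ (by positivity), one_mul]
    have e1 : E ≤ E ^ 18 := le_self_pow₀ hE (by norm_num)
    have e2 : E ^ 18 * X ≤ E ^ 18 * k ^ 2 * X := by
      have : 1 ≤ k ^ 2 := one_le_pow₀ hk
      have : E ^ 18 * 1 ≤ E ^ 18 * k ^ 2 := mul_le_mul_of_nonneg_left this (by positivity)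
      nlinarith
    have e3 : E * (1 / n) ≤ E ^ 18 * X := by
      refine mul_le_mul e1 ?_ (by positivity) (by positivity)
      rw [hX]; gcongr
    have e4 : E * (1 / n) ≤ (1 / 10 ^ 10) ^ 2 := e3.trans (e2.trans hbig)
    rw [mul_one_div, div_le_iff₀ hn0] at e4
    have e5 : ((1 : ℝ) / 10 ^ 10) ^ 2 * n ≤ 1 / 24 * n :=
      mul_le_mul_of_nonneg_right (by norm_num) hn0.le
    linarith
  · have e1 : 2 * (lam / n ^ 2 * (n * (q / (1 / (12 * E)) ^ 2) * k * L)) =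
        288 * (lam * q * X) * (E ^ 2 * k) := by
      rw [hLX]; field_simp; ring
    have e2 : 4 * lam * q * (2 * (n * S) * k) ^ 2 / ((1 / (12 * E)) ^ 6 * (n - 1) ^ 2) ≤
        4 * lam * q * (2 * (n * S) * k) ^ 2 / ((1 / (12 * E)) ^ 6 * (n / 2) ^ 2) := by
      gcongr
    -- `191102976 = 64 * 12 ^ 6`; together with `288 = 2 * 12 ^ 2` it stays below `2 * 10 ^ 8`.
    have e3 : 4 * lam * q * (2 * (n * S) * k) ^ 2 / ((1 / (12 * E)) ^ 6 * (n / 2) ^ 2) =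
        191102976 * (lam * q * X) * (E ^ 6 * k ^ 2) := by
      rw [← hS2]; field_simp; ring
    have e4 : E ^ 2 * k ≤ E ^ 9 * k ^ 2 := mul_le_mul (pow_le_pow_right₀ hE (by norm_num))
      (le_self_pow₀ hk (by norm_num)) hk0.le (by positivity)
    have e5 : E ^ 6 * k ^ 2 ≤ E ^ 9 * k ^ 2 := mul_le_mul_of_nonneg_right
      (pow_le_pow_right₀ hE (by norm_num)) (by positivity)
    have e6 : 0 < lam * q * X := by positivity
    have e7 : 0 < (lam * q * X) * (E ^ 9 * k ^ 2) := by positivity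
    have e8 := mul_le_mul_of_nonneg_left e4 e6.le
    have e9 := mul_le_mul_of_nonneg_left e5 e6.le
    have e10 : lam * q * E ^ 9 * X * k ^ 2 = (lam * q * X) * (E ^ 9 * k ^ 2) := by ring
    rw [e1, e10]
    linarith
  · have e1 : 2 * (n * S) * k / ((1 / (12 * E)) ^ 2 * (n - 1)) ≤
        2 * (n * S) * k / ((1 / (12 * E)) ^ 2 * (n / 2)) := by gcongr
    -- `576 = 4 * 12 ^ 2`; the remaining 2 of the constant 578 covers the contribution of `γ`.
    have e2 : 2 * (n * S) * k / ((1 / (12 * E)) ^ 2 * (n / 2)) = 576 * (S * k) * E ^ 2 := by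
      field_simp; ring
    have e3 : P * q * (2 * 10 ^ 8 * (lam * q * E ^ 9 * X * k ^ 2)) / (4 * (1 / (12 * E)) ^ 2) =
        72 * 10 ^ 8 * (P * (lam * q ^ 2 * E ^ 8 * k * S)) * (S * k * E ^ 3) := by
      have : P * q * (2 * 10 ^ 8 * (lam * q * E ^ 9 * X * k ^ 2)) =
        2 * 10 ^ 8 * (P * q * (lam * q * E ^ 9 * X * k ^ 2)) := by ring
      rw [this, hpqg]; field_simp; ring
    have e4 : 0 < S * k * E ^ 3 := by positivity
    have e5 := mul_le_mul_of_nonneg_right ht e4.le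
    have e6 : S * k * E ^ 2 ≤ S * k * E ^ 3 := mul_le_mul_of_nonneg_left hE23 (by positivity)
    rw [e3]
    linarith
  · have e1 : P * q * (2 * 10 ^ 8 * (lam * q * E ^ 9 * X * k ^ 2)) =
        2 * 10 ^ 8 * (P * (lam * q ^ 2 * E ^ 8 * k * S) * (S * k * E)) := by rw [← hpqg]; ring
    have e2 : S * k * E ≤ S * k * E ^ 3 :=
      mul_le_mul_of_nonneg_left (le_self_pow₀ hE (by norm_num)) (by positivity)
    have e3 : P * (lam * q ^ 2 * E ^ 8 * k * S) * (S * k * E) ≤ 1 / 10 ^ 10 * (1 / 10 ^ 10) :=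
      mul_le_mul ht (e2.trans hx) (by positivity) (by norm_num)
    rw [e1]
    linarith
  · rw [div_pow, le_div_iff₀ (by positivity)]
    have e1 : lam * P ^ 2 * q ^ 3 * (2 * 10 ^ 8 * (lam * q * E ^ 9 * X * k ^ 2)) * (12 * E) ^ 6 =
        597196800000000 * (P ^ 2 * q ^ 3 * (lam ^ 2 * q * E ^ 15 * k ^ 2 * X)) := by ring
    have e2 : P ^ 2 * q ^ 3 * (lam ^ 2 * q * E ^ 15 * k ^ 2 * X) ≤
        P ^ 2 * q ^ 3 * (lam ^ 2 * q * E ^ 18 * k ^ 2 * X) := by gcongr; norm_num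
    rw [e1]
    norm_num at hW ⊢
    linarith

variable {n p : ℕ}

lemma abs_apply_le_covMax (Z : Fin n → Fin n → Fin p → ℝ) (e : OffDiag n) (k : Fin p) :
    |Z e.1.1 e.1.2 k| ≤ covMax Z :=
  (norm_le_pi_norm (Z e.1.1 e.1.2) k).trans
    (le_ciSup (f := fun e : OffDiag n => ‖Z e.1.1 e.1.2‖) (Set.finite_range _).bddAbove e)

lemma covMax_nonneg (Z : Fin n → Fin n → Fin p → ℝ) : 0 ≤ covMax Z :=
  Real.iSup_nonneg fun _ => norm_nonneg _

lemma abs_linPred_le_rho (Z : Fin n → Fin n → Fin p → ℝ) (θ : ThetaIdx n → ℝ) (γ : Fin p → ℝ)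
    {ε₁ ε₂ : ℝ} (h₁ : 0 ≤ ε₁) (h₂ : 0 ≤ ε₂) (e : OffDiag n) :
    |linPred Z θ γ e.1.1 e.1.2| ≤ rho Z θ γ ε₁ ε₂ := by
  have h3 := le_ciSup (f := fun e : OffDiag n => |alpha θ e.1.1 + beta θ e.1.2|)
    (Set.finite_range _).bddAbove e
  have h4 := abs_sum_mul_le Z (abs_apply_le_covMax Z) e γ
  have h5 : 0 ≤ p * covMax Z * ε₂ :=
    mul_nonneg (mul_nonneg (Nat.cast_nonneg p) (covMax_nonneg Z)) h₂
  have h6 := abs_add_le (lin θ e) (∑ k, Z e.1.1 e.1.2 k * γ k)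
  rw [linPred_eq, rho]
  change |lin θ e| ≤ _ at h3
  linarith

/-- The constant 12 is 4, from `exp_neg_abs_le_logisticDeriv`, times 3, a bound for `e` that pays
for the unit displacement. -/
lemma le_logisticDeriv_of_abs_sub_le {x t ρ : ℝ} (hx : |x| ≤ ρ) (ht : |t - x| ≤ 1) :
    1 / (12 * Real.exp ρ) ≤ logisticDeriv t := by
  refine le_trans ?_ (exp_neg_abs_le_logisticDeriv t)
  have h1 : |t| ≤ ρ + 1 := by
    have := abs_add_le (t - x) x
    rw [sub_add_cancel] at this
    linarith
  have h2 : Real.exp (-(ρ + 1)) ≤ Real.exp (-|t|) := Real.exp_le_exp.2 (by linarith)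
  have h3 : Real.exp (ρ + 1) ≤ 3 * Real.exp ρ := by
    rw [Real.exp_add, mul_comm]
    exact mul_le_mul_of_nonneg_right (by linarith [Real.exp_one_lt_d9]) (Real.exp_pos _).le
  have h4 : 1 / (12 * Real.exp ρ) ≤ Real.exp (-(ρ + 1)) / 4 := by
    rw [Real.exp_neg, div_le_div_iff₀ (by positivity) (by norm_num), inv_mul_eq_div,
      le_div_iff₀ (Real.exp_pos _)]
    linarith
  linarith

/-- For a fixed sample size satisfying the rate condition, outside an event of small probability a
moment estimate exists and all moment estimates obey the error bounds. -/
lemma exists_event_momentEstimate {Ω : Type*} [MeasurableSpace Ω] {μ : Measure Ω}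
    [IsProbabilityMeasure μ] {Z : Fin n → Fin n → Fin p → ℝ} {θs : ThetaIdx n → ℝ}
    {γs : Fin p → ℝ} {ε ε₁ ε₂ lam B : ℝ} {A : Ω → Fin n → Fin n → ℤ} {eOut eIn : Ω → Fin n → ℤ}
    (hp : 0 < p) (hn : 3 ≤ n) (hε : 0 < ε) (hε₁ : 0 ≤ ε₁) (hε₂ : 0 ≤ ε₂)
    (hmodel : IsPrivateModel μ Z θs γs ε A eOut eIn) (hB : covMax Z ≤ B)
    (hH : ∀ ω, IsUnit (H Z (A ω) (eOut ω) (eIn ω) θs γs).det ∧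
      linftyNorm (H Z (A ω) (eOut ω) (eIn ω) θs γs)⁻¹ ≤ lam / (n : ℝ) ^ 2)
    (hrate : (p : ℝ) ^ 2 * B ^ 3 * (lam ^ 2 * covMax Z * Real.exp (rho Z θs γs ε₁ ε₂) ^ 18 *
      (1 + kappa ε) ^ 2 * (Real.log n / n)) ≤ (1 / 10 ^ 10) ^ 2) :
    ∃ S : Set Ω, μ.real S ≤ 8 / n + 8 / Real.log n + p * (9 / Real.log n ^ 2) ∧ ∀ ω ∉ S,
      (∃ θ γ, IsMomentEstimate Z (A ω) (eOut ω) (eIn ω) θ γ) ∧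
      ∀ θ γ, IsMomentEstimate Z (A ω) (eOut ω) (eIn ω) θ γ →
        ‖θ - θs‖ ≤ 578 * (Real.sqrt (Real.log n / n) * (1 + kappa ε) *
          Real.exp (rho Z θs γs ε₁ ε₂) ^ 3) ∧
        ‖γ - γs‖ ≤ 2 * 10 ^ 8 * (lam * covMax Z * Real.exp (rho Z θs γs ε₁ ε₂) ^ 9 *
          Real.log n / n * (1 + kappa ε) ^ 2) := by
  set q := covMax Z with hq
  set ρ := rho Z θs γs ε₁ ε₂ with hρ
  set E := Real.exp ρ with hE
  set m := 1 / (12 * E) with hm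
  have hn3 : (3 : ℝ) ≤ n := by exact_mod_cast hn
  have e₀ : OffDiag n := ⟨(⟨0, by omega⟩, ⟨1, by omega⟩), by simp⟩
  have hlin : ∀ e : OffDiag n, |linPred Z θs γs e.1.1 e.1.2| ≤ ρ :=
    abs_linPred_le_rho Z θs γs hε₁ hε₂
  have hE1 : 1 ≤ E := Real.one_le_exp ((abs_nonneg _).trans (hlin e₀))
  have hm0 : 0 < m := by positivity
  have hL : 1 ≤ Real.log n := by
    rw [Real.le_log_iff_exp_le (by linarith)]
    linarith [Real.exp_one_lt_d9]
  have hk := kappa_pos hε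
  have hZq : ∀ (e : OffDiag n) k, |Z e.1.1 e.1.2 k| ≤ q := abs_apply_le_covMax Z
  obtain ⟨ω₀⟩ : Nonempty Ω := nonempty_of_isProbabilityMeasure μ
  have hlam4 := four_le_of_linftyNorm_inv_le Z (A ω₀) (eOut ω₀) (eIn ω₀) θs γs hp hn hZq
    (hH ω₀).1 (hH ω₀).2
  have hq0 : 0 < q := by
    refine (covMax_nonneg Z).lt_of_ne fun h => ?_
    rw [← hq] at h
    rw [← h] at hlam4
    norm_num at hlam4
  have hlam0 : 0 ≤ lam := by
    by_contra h
    have : lam * (p * q ^ 2) ≤ 0 :=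
      mul_nonpos_of_nonpos_of_nonneg (not_le.1 h).le (by positivity)
    linarith
  obtain ⟨c₁, c₂, c₃, c₄, c₅⟩ := rate_conditions (n := n) (L := Real.log n) (E := E)
    (k := 1 + kappa ε) (P := p) (by linarith) hL hE1 (by linarith) hq0 hB
    (by exact_mod_cast hp) hlam4 hrate
  rw [← hm] at c₁ c₂ c₃ c₅
  have hmw : ∀ (e : OffDiag n) (t : ℝ), |t - linPred Z θs γs e.1.1 e.1.2| ≤ 1 →
      m ≤ logisticDeriv t := fun e t ht => le_logisticDeriv_of_abs_sub_le (hlin e) ht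
  have hw : ∀ e, m ≤ weight Z θs γs e := fun e => hmw e _ (by simp)
  -- Zero data serve as a deterministic representative of the coefficients; `projCoeff_data`
  -- identifies them with those of the sample.
  obtain ⟨S, hS, hgood⟩ := exists_event_residuals_le hε hmodel (by omega) (c := q / m ^ 2)
    (by positivity) (r := resid Z 0 0 0 θs γs) (w := projCoeff Z 0 0 0 θs γs)
    (abs_resid_le Z 0 0 0 θs γs hn hm0 c₁ hq0.le hw hZq)
    (fun k => (norm_projCoeff_le Z 0 0 0 θs γs hn hm0 c₁ hq0.le hw hZq k).trans (by
      gcongr; nlinarith [sq_nonneg m]))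
  refine ⟨S, hS, fun ω hω => ?_⟩
  obtain ⟨g₁, g₂, g₃⟩ := hgood ω hω
  have hproj := projCoeff_data Z (A ω) (eOut ω) (eIn ω) θs γs 0 0 0
  have hres : resid Z (A ω) (eOut ω) (eIn ω) θs γs = resid Z 0 0 0 θs γs := by
    funext k e; rw [resid, resid, hproj]
  exact exists_and_forall_momentEstimate Z (A ω) (eOut ω) (eIn ω) θs γs hn hm0 c₁ hq0.le
    (by positivity) hlam0 hmw hZq g₁ g₂ (by rw [hproj, hres]; exact g₃) (hH ω).1 (hH ω).2
    c₂ c₃ c₄ c₅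

end PrivateBeta

/-! ### Passage to the limit. -/

theorem theorem1 {p : ℕ} (hp : 0 < p)
    {Ω : ℕ → Type*} [∀ n, MeasurableSpace (Ω n)]
    (μ : ∀ n, Measure (Ω n)) [∀ n, IsProbabilityMeasure (μ n)]
    (Z : ∀ n, Fin n → Fin n → Fin p → ℝ)
    (θs : ∀ n, PrivateBeta.ThetaIdx n → ℝ) (γs : ℕ → Fin p → ℝ)
    (ε ε₁ ε₂ lam : ℕ → ℝ)
    (hε : ∀ n, 0 < ε n) (hε₁ : ∀ n, 0 < ε₁ n) (hε₂ : ∀ n, 0 < ε₂ n)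
    (A : ∀ n, Ω n → Fin n → Fin n → ℤ) (eOut eIn : ∀ n, Ω n → Fin n → ℤ)
    (hmodel : ∀ n, PrivateBeta.IsPrivateModel (μ n) (Z n) (θs n) (γs n) (ε n)
      (A n) (eOut n) (eIn n))
    (hq : ∃ B : ℝ, ∀ n, PrivateBeta.covMax (Z n) ≤ B)
    (hH : ∀ᶠ n : ℕ in atTop, ∀ (ω : Ω n), ∀ θ ∈ Metric.closedBall (θs n) (ε₁ n),
      IsUnit (PrivateBeta.H (Z n) (A n ω) (eOut n ω) (eIn n ω) θ (γs n)).det ∧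
      PrivateBeta.linftyNorm (PrivateBeta.H (Z n) (A n ω) (eOut n ω) (eIn n ω) θ (γs n))⁻¹
        ≤ lam n / (n : ℝ) ^ 2)
    (hrate : (fun n : ℕ => lam n ^ 2 * PrivateBeta.covMax (Z n) *
        Real.exp (18 * PrivateBeta.rho (Z n) (θs n) (γs n) (ε₁ n) (ε₂ n)) *
        (1 + PrivateBeta.kappa (ε n)) ^ 2)
      =o[atTop] fun n : ℕ => (n : ℝ) / Real.log n) :
    Tendsto (fun n => μ n {ω | ∃ θ γ, PrivateBeta.IsMomentEstimate (Z n) (A n ω)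
        (eOut n ω) (eIn n ω) θ γ}) atTop (𝓝 1) ∧
    (∀ δ : ℝ, 0 < δ → ∃ C : ℝ, 0 < C ∧ ∀ᶠ n : ℕ in atTop,
      (μ n).real {ω | ∃ θ γ, PrivateBeta.IsMomentEstimate (Z n) (A n ω)
          (eOut n ω) (eIn n ω) θ γ ∧
        C * (Real.sqrt (Real.log n / n) * (1 + PrivateBeta.kappa (ε n)) *
          Real.exp (3 * PrivateBeta.rho (Z n) (θs n) (γs n) (ε₁ n) (ε₂ n))) < ‖θ - θs n‖} ≤ δ) ∧
    (∀ δ : ℝ, 0 < δ → ∃ C : ℝ, 0 < C ∧ ∀ᶠ n : ℕ in atTop,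
      (μ n).real {ω | ∃ θ γ, PrivateBeta.IsMomentEstimate (Z n) (A n ω)
          (eOut n ω) (eIn n ω) θ γ ∧
        C * (lam n * PrivateBeta.covMax (Z n) *
          Real.exp (9 * PrivateBeta.rho (Z n) (θs n) (γs n) (ε₁ n) (ε₂ n)) *
          Real.log n / n * (1 + PrivateBeta.kappa (ε n)) ^ 2) < ‖γ - γs n‖} ≤ δ) := by
  obtain ⟨B₀, hB₀⟩ := hq
  set B := max B₀ 1 with hB
  have hB1 : 1 ≤ B := le_max_right _ _
  have hp1 : (1 : ℝ) ≤ p := by exact_mod_cast hp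
  have hpow : ∀ (j : ℕ) (x : ℝ), Real.exp (j * x) = Real.exp x ^ j := fun j x =>
    Real.exp_nat_mul x j
  have hlog : Tendsto (fun n : ℕ => Real.log n) atTop atTop :=
    Real.tendsto_log_atTop.comp tendsto_natCast_atTop_atTop
  set b : ℕ → ℝ := fun n => 8 / n + 8 / Real.log n + p * (9 / Real.log n ^ 2) with hb
  have hb0 : Tendsto b atTop (𝓝 0) := by
    have h1 : Tendsto (fun n : ℕ => (8 : ℝ) / n) atTop (𝓝 0) :=
      tendsto_const_nhds.div_atTop tendsto_natCast_atTop_atTop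
    have h2 : Tendsto (fun n : ℕ => (8 : ℝ) / Real.log n) atTop (𝓝 0) :=
      tendsto_const_nhds.div_atTop hlog
    have h3 : Tendsto (fun n : ℕ => (p : ℝ) * (9 / Real.log n ^ 2)) atTop (𝓝 ((p : ℝ) * 0)) :=
      (tendsto_const_nhds.div_atTop ((tendsto_pow_atTop two_ne_zero).comp hlog)).const_mul _
    simpa using (h1.add h2).add h3
  -- The little-o is used with this one constant, the smallness required by `rate_conditions`;
  -- replacing the covariate bound by `B ≥ 1` keeps it positive.
  have hη : (0 : ℝ) < (1 / 10 ^ 10) ^ 2 / (p ^ 2 * B ^ 3) := by positivity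
  have key : ∀ᶠ n : ℕ in atTop, ∃ S : Set (Ω n), (μ n).real S ≤ b n ∧ ∀ ω ∉ S,
      (∃ θ γ, PrivateBeta.IsMomentEstimate (Z n) (A n ω) (eOut n ω) (eIn n ω) θ γ) ∧
      ∀ θ γ, PrivateBeta.IsMomentEstimate (Z n) (A n ω) (eOut n ω) (eIn n ω) θ γ →
        ‖θ - θs n‖ ≤ 578 * (Real.sqrt (Real.log n / n) * (1 + PrivateBeta.kappa (ε n)) *
          Real.exp (3 * PrivateBeta.rho (Z n) (θs n) (γs n) (ε₁ n) (ε₂ n))) ∧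
        ‖γ - γs n‖ ≤ 2 * 10 ^ 8 * (lam n * PrivateBeta.covMax (Z n) *
          Real.exp (9 * PrivateBeta.rho (Z n) (θs n) (γs n) (ε₁ n) (ε₂ n)) *
          Real.log n / n * (1 + PrivateBeta.kappa (ε n)) ^ 2) := by
    filter_upwards [hH, hrate.def hη, eventually_ge_atTop 3] with n hHn hrn hn
    have hn3 : (3 : ℝ) ≤ n := by exact_mod_cast hn
    have hL : 0 < Real.log n := Real.log_pos (by linarith)
    have e3 := hpow 3 (PrivateBeta.rho (Z n) (θs n) (γs n) (ε₁ n) (ε₂ n))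
    have e9 := hpow 9 (PrivateBeta.rho (Z n) (θs n) (γs n) (ε₁ n) (ε₂ n))
    have e18 := hpow 18 (PrivateBeta.rho (Z n) (θs n) (γs n) (ε₁ n) (ε₂ n))
    push_cast at e3 e9 e18
    rw [e18] at hrn
    rw [e3, e9]
    refine PrivateBeta.exists_event_momentEstimate hp hn (hε n) (hε₁ n).le (hε₂ n).le (hmodel n)
      ((hB₀ n).trans (le_max_left _ _ : B₀ ≤ B))
      (fun ω => hHn ω (θs n) (Metric.mem_closedBall_self (hε₁ n).le)) ?_
    have h1 := (le_abs_self _).trans hrn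
    rw [Real.norm_eq_abs, abs_of_pos (show (0 : ℝ) < n / Real.log n by positivity)] at h1
    have h2 := mul_le_mul_of_nonneg_right h1 (show (0 : ℝ) ≤ Real.log n / n by positivity)
    have h3 : (1 / 10 ^ 10) ^ 2 / ((p : ℝ) ^ 2 * B ^ 3) * (n / Real.log n) * (Real.log n / n) =
        (1 / 10 ^ 10) ^ 2 / (p ^ 2 * B ^ 3) := by field_simp
    rw [h3, le_div_iff₀ (by positivity)] at h2
    linarith
  have hsmall : ∀ δ : ℝ, 0 < δ → ∀ᶠ n in atTop, b n ≤ δ := fun δ hδ =>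
    (hb0.eventually_lt_const hδ).mono fun _ h => h.le
  refine ⟨?_, fun δ hδ => ⟨578, by norm_num, ?_⟩, fun δ hδ => ⟨2 * 10 ^ 8, by norm_num, ?_⟩⟩
  · rw [← ENNReal.tendsto_toReal_iff (fun n => measure_ne_top _ _) ENNReal.one_ne_top]
    have hlow : Tendsto (fun n => 1 - b n) atTop (𝓝 1) := by
      simpa using hb0.const_sub 1
    refine tendsto_of_tendsto_of_tendsto_of_le_of_le' hlow tendsto_const_nhds ?_
      (Eventually.of_forall fun n => measureReal_le_one)
    filter_upwards [key] with n ⟨S, hS, hgood⟩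
    -- Covering the space and using subadditivity avoids complements, so no measurability of the
    -- existence event is needed.
    have h1 : (Set.univ : Set (Ω n)) ⊆ {ω | ∃ θ γ, PrivateBeta.IsMomentEstimate (Z n) (A n ω)
        (eOut n ω) (eIn n ω) θ γ} ∪ S := fun ω _ => by
      by_cases hω : ω ∈ S
      · exact Or.inr hω
      · exact Or.inl (hgood ω hω).1
    have h2 := (measureReal_mono (μ := μ n) h1).trans (measureReal_union_le _ _)
    rw [probReal_univ] at h2
    change 1 - b n ≤ (μ n).real _
    linarith
  · filter_upwards [key, hsmall δ hδ] with n ⟨S, hS, hgood⟩ hbn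
    refine (measureReal_mono ?_).trans (hS.trans hbn)
    rintro ω ⟨θ, γ, hest, hlt⟩
    by_contra hω
    exact absurd hlt (not_lt.2 ((hgood ω hω).2 θ γ hest).1)
  · filter_upwards [key, hsmall δ hδ] with n ⟨S, hS, hgood⟩ hbn
    refine (measureReal_mono ?_).trans (hS.trans hbn)
    rintro ω ⟨θ, γ, hest, hlt⟩
    by_contra hω
    exact absurd hlt (not_lt.2 ((hgood ω hω).2 θ γ hest).2)
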